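/- An integer linear system (ILS) is a triple $I=(A,\boldsymbol b,d)$ with $A\in\mathbb Q^{m\times n}$, $\boldsymbol b\in\mathbb Q^m$, and positive integers $m,n,d$. A feasible solution is a vector $\boldsymbol x\in\{0,1,\dots,d\}^n$ with $A\boldsymbol x\ge \boldsymbol b$. The solution graph $G(I)$ has the feasible solutions as vertices, two of them being adjacent if they differ in exactly one coordinate; $\boldsymbol t$ is reachable from $\boldsymbol s$ if $G(I)$ contains a path from $\boldsymbol s$ to $\boldsymbol t$. The reconfiguration problem asks, given $I$ and two feasible solutions $\boldsymbol s,\boldsymbol t$ of $I$, whether $\boldsymbol t$ is reachable from $\boldsymbol s$. The input size is the total binary length of $m,n,A,\boldsymbol b,d,\boldsymbol s,\boldsymbol t$ (so $d$ contributes $\Theta(\log d)$). The complexity index $Z(I)$ is the minimum of $Z$ over all real $Z,\alpha_1,\dots,\alpha_n$ with $0\le\alpha_j\le 1$ for all $j$ and $\sum_{j:a_{ij}>0}\alpha_j+\sum_{j:a_{ij}<0}(1-\alpha_j)\le Z$ for all $i$; ILS$(1)$ is the class of all $I$ with $Z(I)\le 1$. The system $I$ is unit if all entries of $A$ lie in $\{0,1,-1\}$,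 Horn if each row of $A$ has at most one positive entry, TVPI if each row of $A$ has at most two nonzero entries, and UTVPI if it is unit and TVPI. Theorem. 1. The reconfiguration problem of unit ILS$(1)$ is solvable in time polynomial in the input size. 2. In particular, the reconfiguration problems of unit Horn ILS and of UTVPI ILS are solvable in time polynomial in the input size. 3. Let $I$ be a UTVPI ILS with feasible solutions $\boldsymbol s,\boldsymbol t$. Put $p=\max_j|s_j-t_j|$, and for $i\ge 0$ let $\boldsymbol u^i$ be the vector with $u^i_j=\max(s_j-i,t_j)$ if $t_j\le s_j$ and $u^i_j=\min(s_j+i,t_j)$ otherwise; so $\boldsymbol u^i=\max(\boldsymbol s-i\mathbf 1,\boldsymbol t)$ if $\boldsymbol t\le\boldsymbol s$. Then the following are equivalent: (a) $\boldsymbol t$ is reachable from $\boldsymbol s$ in $G(I)$; (b) $\boldsymbol u^{i+1}$ is reachable from $\boldsymbol u^i$ in $G(I)$ for all $0\le i\le p-1$; (c) $\boldsymbol u^1$ is reachable from $\boldsymbol s$ in $G(I)$. (Reachability of one vector from another includes that both are feasible.) 4. Distances, and hence diameters of connected components, of $G(I)$ can be exponential in the input size: there is a constant $c>0$ such that there are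 inputs $(I,\boldsymbol s,\boldsymbol t)$ of arbitrarily large size $N$, with $I$ in unit ILS$(1)$ and both Horn and TVPI, such that $\boldsymbol t$ is reachable from $\boldsymbol s$ and the distance from $\boldsymbol s$ to $\boldsymbol t$ in $G(I)$ is at least $2^{N/c}$. -/

import Mathlib

open scoped Matrix

/-! ## Integer linear systems and their solution graphs -/

/-- An integer linear system `A x ≥ b`, `x ∈ {0, …, d}ⁿ`, with rational data and positive `m, n, d`. -/
structure ILS where
  m : ℕ
  n : ℕ
  m_pos : 0 < m
  n_pos : 0 < n
  A : Matrix (Fin m) (Fin n) ℚ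
  b : Fin m → ℚ
  d : ℕ
  d_pos : 0 < d

namespace ILS

/-- `x` is an integer vector in `{0, …, d}ⁿ` with `A x ≥ b`. -/
def IsFeasible (I : ILS) (x : Fin I.n → ℤ) : Prop :=
  (∀ j, 0 ≤ x j ∧ x j ≤ (I.d : ℤ)) ∧ I.b ≤ I.A *ᵥ fun j => (x j : ℚ)

/-- The solution graph: feasible solutions, adjacent when they differ in exactly one variable
(whose value may change arbitrarily). -/
def solutionGraph (I : ILS) : SimpleGraph {x : Fin I.n → ℤ // I.IsFeasible x} where
  Adj x y := hammingDist x.1 y.1 = 1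
  symm := ⟨fun x y h => by rw [hammingDist_comm]; exact h⟩
  loopless := ⟨fun x h => by simp at h⟩

/-- `x` and `y` are feasible solutions and `y` is reachable from `x` in the solution graph. -/
def Reachable (I : ILS) (x y : Fin I.n → ℤ) : Prop :=
  ∃ (hx : I.IsFeasible x) (hy : I.IsFeasible y), I.solutionGraph.Reachable ⟨x, hx⟩ ⟨y, hy⟩

/-- `(Z, α)` satisfies the constraints of the linear program that defines the complexity index. -/
def IndexLPFeasible (I : ILS) (Z : ℝ) (α : Fin I.n → ℝ) : Prop :=
  (∀ j, 0 ≤ α j ∧ α j ≤ 1) ∧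
    ∀ i, ∑ j with 0 < I.A i j, α j + ∑ j with I.A i j < 0, (1 - α j) ≤ Z

/-- The complexity index `Z(I)`: the optimal value of the linear program that minimizes `Z`. -/
noncomputable def complexityIndex (I : ILS) : ℝ :=
  sInf {Z : ℝ | ∃ α, I.IndexLPFeasible Z α}

/-- Membership in the family `ILS(γ)`. -/
def InILS (γ : ℝ) (I : ILS) : Prop := I.complexityIndex ≤ γ

/-- All entries of the matrix lie in `{0, 1, -1}`. -/
def IsUnit (I : ILS) : Prop := ∀ i j, I.A i j = 0 ∨ I.A i j = 1 ∨ I.A i j = -1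

/-- Each row of the matrix has at most one positive entry. -/
def IsHorn (I : ILS) : Prop := ∀ i, (Finset.univ.filter fun j => 0 < I.A i j).card ≤ 1

/-- Each row of the matrix has at most two nonzero entries. -/
def IsTVPI (I : ILS) : Prop := ∀ i, (Finset.univ.filter fun j => I.A i j ≠ 0).card ≤ 2

/-- Move every coordinate of `s` by at most `i` towards `t`.
If `t ≤ s`, this is the vector `max (s - i·1, t)`. -/
def moveToward {n : ℕ} (s t : Fin n → ℤ) (i : ℕ) : Fin n → ℤ := fun j =>
  if t j ≤ s j then max (s j - i) (t j) else min (s j + i) (t j)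

end ILS

/-- An input of the reconfiguration problem: a system and two feasible solutions of it. -/
structure ReconfInput where
  I : ILS
  s : Fin I.n → ℤ
  t : Fin I.n → ℤ
  s_feasible : I.IsFeasible s
  t_feasible : I.IsFeasible t

/-! ## A programming language with bit-cost semantics

Programs work on finite binary trees with integers at the leaves. Every operation is charged the
total number of bits of the values that it reads and writes, so a computation of cost `T` handles
only values of at most `T` bits, and it takes a multitape Turing machine a number of steps
polynomial in `T`. Conversely a Turing machine is simulated with polynomial overhead. Hence
polynomial cost in this model is polynomial time in the usual sense. -/

namespace WhileLang

/-- Values: binary trees with integers at the leaves. -/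
inductive Val where
  | int (z : ℤ)
  | pair (a b : Val)

/-- The size of a value: its binary integers are written out, with one extra symbol per node. -/
def Val.size : Val → ℕ
  | .int z => Nat.size z.natAbs + 1
  | .pair a b => a.size + b.size + 1

/-- A test succeeds if it yields a positive integer. -/
def Val.IsTrue : Val → Prop
  | .int z => 0 < z
  | .pair _ _ => False

/-- Apply a binary integer operation to a pair of integers (default value `0`). -/
def Val.binop (f : ℤ → ℤ → ℤ) : Val → Val
  | .pair (.int x) (.int y) => .int (f x y)
  | _ => .int 0

/-- Primitive operations. -/
inductive Op where
  | id
  | const (z : ℤ)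
  | fst
  | snd
  | isPair
  | add
  | sub
  | mul
  | div

/-- The result of a primitive operation. -/
def Op.apply : Op → Val → Val
  | .id, x => x
  | .const z, _ => .int z
  | .fst, .pair a _ => a
  | .fst, .int _ => .int 0
  | .snd, .pair _ b => b
  | .snd, .int _ => .int 0
  | .isPair, .pair _ _ => .int 1
  | .isPair, .int _ => .int 0
  | .add, x => x.binop (· + ·)
  | .sub, x => x.binop (· - ·)
  | .mul, x => x.binop (· * ·)
  | .div, x => x.binop (· / ·)

/-- Programs; each transforms one value. -/
inductive Prog where
  | op (o : Op)
  /-- run both programs on the current value and pair the results -/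
  | pair (p q : Prog)
  /-- run `p`, then `q` on its result -/
  | seq (p q : Prog)
  /-- if the test `c` succeeds on the current value, run `p`, otherwise `q` -/
  | cond (c p q : Prog)
  /-- while the test `c` succeeds on the current value, replace this value by running `p` -/
  | loop (c p : Prog)

/-- `Runs p x y k`: the program `p`, started on `x`, halts with result `y` at total cost `k`. -/
inductive Runs : Prog → Val → Val → ℕ → Prop where
  | op (o : Op) (x : Val) : Runs (.op o) x (o.apply x) (x.size + (o.apply x).size)
  | pair {p q : Prog} {x a b : Val} {k l : ℕ} (hp : Runs p x a k) (hq : Runs q x b l) :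
      Runs (.pair p q) x (.pair a b) (k + l + x.size + (Val.pair a b).size)
  | seq {p q : Prog} {x y z : Val} {k l : ℕ} (hp : Runs p x y k) (hq : Runs q y z l) :
      Runs (.seq p q) x z (k + l + 1)
  | condTrue {c p q : Prog} {x v y : Val} {k l : ℕ} (hc : Runs c x v k) (hv : v.IsTrue)
      (hp : Runs p x y l) : Runs (.cond c p q) x y (k + l + x.size)
  | condFalse {c p q : Prog} {x v y : Val} {k l : ℕ} (hc : Runs c x v k) (hv : ¬ v.IsTrue)
      (hq : Runs q x y l) : Runs (.cond c p q) x y (k + l + x.size)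
  | loopStop {c p : Prog} {x v : Val} {k : ℕ} (hc : Runs c x v k) (hv : ¬ v.IsTrue) :
      Runs (.loop c p) x x (k + x.size)
  | loopStep {c p : Prog} {x v y z : Val} {k l r : ℕ} (hc : Runs c x v k) (hv : v.IsTrue)
      (hp : Runs p x y l) (hl : Runs (.loop c p) y z r) :
      Runs (.loop c p) x z (k + l + r + x.size)

/-- Programs are deterministic: result and cost are unique. -/
theorem Runs.unique {p : Prog} {x y y' : Val} {k k' : ℕ} (h : Runs p x y k)
    (h' : Runs p x y' k') : y = y' ∧ k = k' := by
  induction h generalizing y' k' with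
  | op o x => cases h'; exact ⟨rfl, rfl⟩
  | pair _ _ ihp ihq =>
    cases h' with
    | pair hp hq =>
      obtain ⟨rfl, rfl⟩ := ihp hp
      obtain ⟨rfl, rfl⟩ := ihq hq
      exact ⟨rfl, rfl⟩
  | seq _ _ ihp ihq =>
    cases h' with
    | seq hp hq =>
      obtain ⟨rfl, rfl⟩ := ihp hp
      obtain ⟨rfl, rfl⟩ := ihq hq
      exact ⟨rfl, rfl⟩
  | condTrue _ hv _ ihc ihp =>
    cases h' with
    | condTrue hc _ hp =>
      obtain ⟨rfl, rfl⟩ := ihc hc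
      obtain ⟨rfl, rfl⟩ := ihp hp
      exact ⟨rfl, rfl⟩
    | condFalse hc hv' _ =>
      obtain ⟨rfl, rfl⟩ := ihc hc
      exact absurd hv hv'
  | condFalse _ hv _ ihc ihq =>
    cases h' with
    | condFalse hc _ hq =>
      obtain ⟨rfl, rfl⟩ := ihc hc
      obtain ⟨rfl, rfl⟩ := ihq hq
      exact ⟨rfl, rfl⟩
    | condTrue hc hv' _ =>
      obtain ⟨rfl, rfl⟩ := ihc hc
      exact absurd hv' hv
  | loopStop _ hv ihc =>
    cases h' with
    | loopStop hc _ =>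
      obtain ⟨rfl, rfl⟩ := ihc hc
      exact ⟨rfl, rfl⟩
    | loopStep hc hv' _ _ =>
      obtain ⟨rfl, rfl⟩ := ihc hc
      exact absurd hv' hv
  | loopStep _ hv _ _ ihc ihp ihl =>
    cases h' with
    | loopStop hc hv' =>
      obtain ⟨rfl, rfl⟩ := ihc hc
      exact absurd hv hv'
    | loopStep hc _ hp hl =>
      obtain ⟨rfl, rfl⟩ := ihc hc
      obtain ⟨rfl, rfl⟩ := ihp hp
      obtain ⟨rfl, rfl⟩ := ihl hl
      exact ⟨rfl, rfl⟩

/-- Lists are nested pairs, ended by the integer `0`. -/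
def Val.ofList : List Val → Val
  | [] => .int 0
  | v :: l => .pair v (Val.ofList l)

/-- Vectors are lists of their entries. -/
def Val.ofVec {k : ℕ} (v : Fin k → Val) : Val := Val.ofList (List.ofFn v)

/-- A rational number is the pair of its numerator and its denominator in lowest terms. -/
def Val.ofRat (q : ℚ) : Val := .pair (.int q.num) (.int q.den)

end WhileLang

open WhileLang in
/-- The encoding of an input: `m, n, A` (row by row)`, b, d, s, t`, all numbers in binary. -/
def ReconfInput.encode (x : ReconfInput) : Val :=
  .pair (.int x.I.m) <| .pair (.int x.I.n) <|
  .pair (Val.ofVec fun i => Val.ofVec fun j => Val.ofRat (x.I.A i j)) <|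
  .pair (Val.ofVec fun i => Val.ofRat (x.I.b i)) <|
  .pair (.int x.I.d) <|
  .pair (Val.ofVec fun j => .int (x.s j)) (Val.ofVec fun j => .int (x.t j))

/-- The input size: the number of symbols of the encoding, in which `d` contributes `Θ(log d)`. -/
def ReconfInput.size (x : ReconfInput) : ℕ := x.encode.size

open WhileLang in
open Classical in
/-- The reconfiguration problem of the systems in the class `C` is polynomially solvable: one
program decides reachability, with answer `1` or `0`, on every input whose system lies in `C`, at
cost bounded by one polynomial in the input size. -/
def PolynomiallySolvable (C : ILS → Prop) : Prop :=
  ∃ (P : Prog) (f : Polynomial ℕ), ∀ x : ReconfInput, C x.I →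
    ∃ k : ℕ, k ≤ f.eval x.size ∧
      Runs P x.encode (.int (if x.I.Reachable x.s x.t then 1 else 0)) k

/-! ## Polynomial-time computable functions -/

namespace WhileLang

/-! A solution of the index program with value at most 1 rounds to weights 0, 1/2, 1, recorded as `ε
j ∈ {-1, 0, 1}`. A row then either has a head, a literal of weight 1 beside which all others have
weight 0, or it has at most two literals of weight 1/2 and otherwise weight 0. Up to reflection,
rows with a head are Horn rows in the labelled coordinates (`ε j ≠ 0`). In the other rows, lowering
`ε j * x j` on labelled coordinates only helps, and at most two unlabelled coordinates occur.

Labelled coordinates: each component has a point that minimizes all `ε j * x j` simultaneously. The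
displacements `z` from `s` to it form the greatest fixed point of `z j = min (cap j) (slack i + ∑ z
k)`, over the rows `i` with head `j` and the body members `k`, with capacities set to 0 outside the
coordinates that can move at all. Without this restriction, a cycle of tight rows could support a
spurious fixed point. `IsLabeling.displacement_le` shows that nothing reachable goes further;
`IsLabeling.joined_descent` reaches the fixed point by unit steps, because by `eq_of_stuck` no
smaller displacement is stuck. By `iterate_stationary`, `n` rounds of iteration from above suffice,
however large `d` is. Least points of the same component agree on the labelled coordinates.

Unlabelled coordinates: if `s` and `t` agree on the labelled ones and `s` is least there, only rows
with two unknowns matter (`IsLabeling.feas_of_two`). The maps `clamp` truncate a path from `s` to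
`t` to one from `s` to the first unit step; the maps `shift` translate a path of the first unit step
to every later one. Hence `t` is reachable iff the first unit step is. With all labels 0 this gives
the equivalences for UTVPI systems. Inside the first unit step a solution is a set of moved
coordinates. Feasible sets are closed under union (`IsLabeling.feas_moved_union`), so greedy
insertion decides reachability (`IsLabeling.joined_one_iff`).

The labeling is found as in 2-SAT: a closed sparse set of literals always extends to a full one
(`exists_extension`), so propagation needs no backtracking. All these procedures are compositions of
folds whose accumulators stay polynomially bounded. Exponential distance already occurs along the
corridor `|x₀ - x₁| ≤ 1`. -/

theorem polynomial_eval_mono (p : Polynomial ℕ) {a b : ℕ} (h : a ≤ b) : p.eval a ≤ p.eval b := by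
  induction p using Polynomial.induction_on' with
  | add p q hp hq => simpa using add_le_add hp hq
  | monomial n c => simpa using Nat.mul_le_mul_left c (Nat.pow_le_pow_left h n)

theorem Val.size_pos (v : Val) : 0 < v.size := by
  cases v <;> simp [Val.size]

/-- `P` transforms `x` into `y` at cost at most `n`. -/
def RunsIn (P : Prog) (x y : Val) (n : ℕ) : Prop := ∃ k ≤ n, Runs P x y k

theorem RunsIn.mono {P : Prog} {x y : Val} {m n : ℕ} (h : RunsIn P x y m) (hmn : m ≤ n) :
    RunsIn P x y n := by
  obtain ⟨k, hk, h⟩ := h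
  exact ⟨k, hk.trans hmn, h⟩

/-- Every rule charges for the value it outputs, so a bound on the cost is also a bound on the
output size. -/
theorem Runs.size_le {P : Prog} {x y : Val} {k : ℕ} (h : Runs P x y k) : y.size ≤ k := by
  induction h <;> omega

theorem RunsIn.size_le {P : Prog} {x y : Val} {n : ℕ} (h : RunsIn P x y n) : y.size ≤ n := by
  obtain ⟨k, hk, h⟩ := h
  exact h.size_le.trans hk

theorem RunsIn.op (o : Op) (x : Val) : RunsIn (.op o) x (o.apply x) (x.size + (o.apply x).size) :=
  ⟨_, le_rfl, .op o x⟩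

theorem RunsIn.pair {P Q : Prog} {x a b : Val} {k l : ℕ} (hP : RunsIn P x a k)
    (hQ : RunsIn Q x b l) : RunsIn (.pair P Q) x (.pair a b) (2 * (k + l) + x.size + 1) := by
  have ha := hP.size_le
  have hb := hQ.size_le
  obtain ⟨k', hk, hP⟩ := hP
  obtain ⟨l', hl, hQ⟩ := hQ
  exact ⟨_, by simp only [Val.size]; omega, hP.pair hQ⟩

theorem RunsIn.seq {P Q : Prog} {x y z : Val} {k l : ℕ} (hP : RunsIn P x y k)
    (hQ : RunsIn Q y z l) : RunsIn (.seq P Q) x z (k + l + 1) := by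
  obtain ⟨k', hk, hP⟩ := hP
  obtain ⟨l', hl, hQ⟩ := hQ
  exact ⟨_, by omega, hP.seq hQ⟩

/-- Encodings of data types as values. -/
class Enc (α : Type*) where
  /-- the value that represents a datum -/
  enc : α → Val

instance : Enc ℤ := ⟨Val.int⟩
instance : Enc ℕ := ⟨fun n => Val.int n⟩
instance : Enc Bool := ⟨fun b => Val.int (cond b 1 0)⟩
instance {α β : Type*} [Enc α] [Enc β] : Enc (α × β) := ⟨fun p => .pair (Enc.enc p.1) (Enc.enc p.2)⟩
instance {α : Type*} [Enc α] : Enc (List α) := ⟨fun l => Val.ofList (l.map Enc.enc)⟩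

/-- The size of the encoding of a datum. -/
def esize {α : Type*} [Enc α] (a : α) : ℕ := (Enc.enc a).size

theorem esize_pos {α : Type*} [Enc α] (a : α) : 0 < esize a := Val.size_pos _

theorem esize_prod {α β : Type*} [Enc α] [Enc β] (p : α × β) :
    esize p = esize p.1 + esize p.2 + 1 := rfl

theorem esize_int (z : ℤ) : esize z = Nat.size z.natAbs + 1 := rfl

theorem esize_nat (n : ℕ) : esize n = Nat.size n + 1 := rfl

theorem esize_bool (b : Bool) : esize b ≤ 2 := by
  cases b <;> simp [esize, Enc.enc, Val.size]

theorem esize_nil {α : Type*} [Enc α] : esize ([] : List α) = 1 := by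
  simp [esize, Enc.enc, Val.size, Val.ofList]

theorem esize_cons {α : Type*} [Enc α] (a : α) (l : List α) :
    esize (a :: l) = esize a + esize l + 1 := rfl

theorem esize_append {α : Type*} [Enc α] (l l' : List α) :
    esize (l ++ l') + 1 = esize l + esize l' := by
  induction l with
  | nil => simp [esize_nil]; omega
  | cons a l ih => simp only [List.cons_append, esize_cons]; omega

theorem esize_mem {α : Type*} [Enc α] {a : α} {l : List α} (h : a ∈ l) : esize a ≤ esize l := by
  induction l with
  | nil => simp at h
  | cons b l ih =>
    rw [esize_cons]
    rcases List.mem_cons.1 h with rfl | h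
    · omega
    · have := ih h; omega

theorem length_le_esize {α : Type*} [Enc α] (l : List α) : l.length ≤ esize l := by
  induction l with
  | nil => simp
  | cons b l ih => rw [esize_cons, List.length_cons]; omega

theorem esize_le_of_sublist {α : Type*} [Enc α] {l l' : List α} (h : l.Sublist l') :
    esize l ≤ esize l' := by
  induction h with
  | slnil => exact le_rfl
  | cons a _ ih => rw [esize_cons]; omega
  | cons_cons a _ ih => rw [esize_cons, esize_cons]; omega

theorem esize_reverse {α : Type*} [Enc α] (l : List α) : esize l.reverse = esize l := by
  induction l with
  | nil => rfl
  | cons a l ih =>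
    have := esize_append l.reverse [a]
    rw [esize_cons, esize_nil] at this
    rw [List.reverse_cons, esize_cons]
    omega

theorem esize_le_of_forall {α : Type*} [Enc α] {l : List α} {B : ℕ} (h : ∀ a ∈ l, esize a ≤ B) :
    esize l ≤ l.length * (B + 1) + 1 := by
  induction l with
  | nil => simp [esize_nil]
  | cons a l ih =>
    have h1 := ih fun b hb => h b (List.mem_cons_of_mem _ hb)
    have h2 := h a (by simp)
    rw [esize_cons, List.length_cons, add_one_mul]
    omega

/-- `f` is computed by a program whose cost is polynomial in the size of the argument. -/
@[fun_prop]
def PolyComp {α β : Type*} [Enc α] [Enc β] (f : α → β) : Prop :=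
  ∃ (P : Prog) (p : Polynomial ℕ), ∀ a, RunsIn P (Enc.enc a) (Enc.enc (f a)) (p.eval (esize a))

/-- The size of `f a` is polynomial in the size of `a`. -/
def PolyBdd {α β : Type*} [Enc α] [Enc β] (f : α → β) : Prop :=
  ∃ p : Polynomial ℕ, ∀ a, esize (f a) ≤ p.eval (esize a)

/-! ### Composition, pairing and case distinction. -/

section Basic

variable {α β γ δ : Type*} [Enc α] [Enc β] [Enc γ] [Enc δ]

theorem PolyComp.polyBdd {f : α → β} (hf : PolyComp f) : PolyBdd f := by
  obtain ⟨P, p, h⟩ := hf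
  exact ⟨p, fun a => (h a).size_le⟩

/-- Only encodings matter, so a function may be replaced by one whose values are encoded alike, even
in another type. -/
theorem PolyComp.of_enc {f : α → β} {g : α → γ} (hf : PolyComp f)
    (h : ∀ a, Enc.enc (g a) = Enc.enc (f a)) : PolyComp g := by
  obtain ⟨P, p, hP⟩ := hf
  exact ⟨P, p, fun a => by rw [h]; exact hP a⟩

/-- One primitive operation with output of linear size. -/
theorem PolyComp.of_op {f : α → β} (o : Op) (c : ℕ) (h : ∀ a, o.apply (Enc.enc a) = Enc.enc (f a))
    (hs : ∀ a, esize (f a) ≤ esize a + c) : PolyComp f := by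
  refine ⟨.op o, 2 * Polynomial.X + Polynomial.C c, fun a => ?_⟩
  rw [← h]
  refine (RunsIn.op o _).mono ?_
  have := hs a
  rw [h]
  simp only [esize, Polynomial.eval_add, Polynomial.eval_mul, Polynomial.eval_X,
    Polynomial.eval_C, Polynomial.eval_ofNat] at *
  omega

@[fun_prop]
theorem PolyComp.id : PolyComp (fun a : α => a) :=
  .of_op .id 0 (fun _ => rfl) (fun _ => le_rfl)

@[fun_prop]
theorem PolyComp.fst : PolyComp (Prod.fst : α × β → α) :=
  .of_op .fst 0 (fun _ => rfl) (fun a => by rw [esize_prod]; omega)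

@[fun_prop]
theorem PolyComp.snd : PolyComp (Prod.snd : α × β → β) :=
  .of_op .snd 0 (fun _ => rfl) (fun a => by rw [esize_prod]; omega)

@[fun_prop]
theorem PolyComp.const (b : β) : PolyComp (fun _ : α => b) := by
  suffices H : ∀ v : Val, ∃ (P : Prog) (p : Polynomial ℕ), ∀ x : Val, RunsIn P x v (p.eval x.size) by
    obtain ⟨P, p, h⟩ := H (Enc.enc b)
    exact ⟨P, p, fun a => h _⟩
  intro v
  induction v with
  | int z =>
    refine ⟨.op (.const z), Polynomial.X + Polynomial.C (Val.int z).size, fun x => ?_⟩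
    exact (RunsIn.op (.const z) x).mono (by simp [Op.apply])
  | pair a b iha ihb =>
    obtain ⟨P, p, hP⟩ := iha
    obtain ⟨Q, q, hQ⟩ := ihb
    exact ⟨.pair P Q, 2 * (p + q) + Polynomial.X + 1, fun x => ((hP x).pair (hQ x)).mono (by simp)⟩

theorem PolyComp.comp {g : β → γ} {f : α → β} (hg : PolyComp g) (hf : PolyComp f) :
    PolyComp (fun a => g (f a)) := by
  obtain ⟨P, p, hP⟩ := hf
  obtain ⟨Q, q, hQ⟩ := hg
  refine ⟨.seq P Q, p + q.comp p + 1, fun a => ((hP a).seq (hQ (f a))).mono ?_⟩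
  have := polynomial_eval_mono q (hP a).size_le
  simp only [Polynomial.eval_add, Polynomial.eval_comp, Polynomial.eval_one]
  simpa [esize] using this

attribute [fun_prop] PolyComp.comp

@[fun_prop]
theorem PolyComp.prodMk {f : α → β} {g : α → γ} (hf : PolyComp f) (hg : PolyComp g) :
    PolyComp (fun a => (f a, g a)) := by
  obtain ⟨P, p, hP⟩ := hf
  obtain ⟨Q, q, hQ⟩ := hg
  refine ⟨.pair P Q, 2 * (p + q) + Polynomial.X + 1, fun a => ((hP a).pair (hQ a)).mono ?_⟩
  simp [esize]

theorem bool_isTrue (b : Bool) : (Enc.enc b).IsTrue ↔ b = true := by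
  cases b <;> simp [Enc.enc, Val.IsTrue]

/-- Case distinction by an arbitrary test. -/
theorem PolyComp.cond_of_isTrue {t : α → δ} {c : α → Bool} {f g : α → β} (ht : PolyComp t)
    (h : ∀ a, (Enc.enc (t a)).IsTrue ↔ c a = true) (hf : PolyComp f) (hg : PolyComp g) :
    PolyComp (fun a => cond (c a) (f a) (g a)) := by
  obtain ⟨P, p, hP⟩ := hf
  obtain ⟨Q, q, hQ⟩ := hg
  obtain ⟨T, r, hT⟩ := ht
  refine ⟨.cond T P Q, r + p + q + Polynomial.X, fun a => ?_⟩
  obtain ⟨k, hk, hT⟩ := hT a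
  cases hc : c a with
  | true =>
    obtain ⟨l, hl, hP⟩ := hP a
    refine ⟨_, ?_, by simpa only [hc, cond_true] using Runs.condTrue hT ((h a).2 hc) hP⟩
    simp only [Polynomial.eval_add, Polynomial.eval_X, esize] at *
    omega
  | false =>
    obtain ⟨l, hl, hQ⟩ := hQ a
    refine ⟨_, ?_, by simpa only [hc, cond_false] using Runs.condFalse hT (fun hv => by simp [(h a).1 hv] at hc) hQ⟩
    simp only [Polynomial.eval_add, Polynomial.eval_X, esize] at *
    omega

@[fun_prop]
theorem PolyComp.cond {c : α → Bool} {f g : α → β} (hc : PolyComp c)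
    (hf : PolyComp f) (hg : PolyComp g) : PolyComp (fun a => cond (c a) (f a) (g a)) :=
  .cond_of_isTrue hc (fun a => bool_isTrue (c a)) hf hg

theorem PolyComp.and {c d : α → Bool} (hc : PolyComp c) (hd : PolyComp d) :
    PolyComp (fun a => c a && d a) :=
  (PolyComp.cond hc hd (.const false)).of_enc fun a => by cases c a <;> rfl

theorem PolyComp.or {c d : α → Bool} (hc : PolyComp c) (hd : PolyComp d) :
    PolyComp (fun a => c a || d a) :=
  (PolyComp.cond hc (.const true) hd).of_enc fun a => by cases c a <;> rfl

theorem PolyComp.not {c : α → Bool} (hc : PolyComp c) : PolyComp (fun a => !c a) :=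
  (PolyComp.cond hc (.const false) (.const true)).of_enc fun a => by cases c a <;> rfl

attribute [fun_prop] PolyComp.and PolyComp.or PolyComp.not

end Basic

/-! ### Integer arithmetic and comparisons. -/

section Arithmetic

variable {α β γ δ : Type*} [Enc α] [Enc β] [Enc γ] [Enc δ]

theorem size_add_le (a b : ℕ) : Nat.size (a + b) ≤ Nat.size a + Nat.size b + 1 := by
  rw [Nat.size_le]
  have ha := Nat.lt_size_self a
  have hb := Nat.lt_size_self b
  have h1 : 2 ^ a.size ≤ 2 ^ (a.size + b.size) := Nat.pow_le_pow_right (by norm_num) (by omega)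
  have h2 : 2 ^ b.size ≤ 2 ^ (a.size + b.size) := Nat.pow_le_pow_right (by norm_num) (by omega)
  rw [pow_succ]
  omega

theorem size_mul_le (a b : ℕ) : Nat.size (a * b) ≤ Nat.size a + Nat.size b := by
  rcases Nat.eq_zero_or_pos b with rfl | hb
  · simp
  rw [Nat.size_le, pow_add]
  exact Nat.mul_lt_mul'' (Nat.lt_size_self a) (Nat.lt_size_self b)

theorem esize_add_le (a b : ℤ) : esize (a + b) ≤ esize a + esize b := by
  have h1 := Nat.size_le_size (Int.natAbs_add_le a b)
  have h2 := size_add_le a.natAbs b.natAbs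
  simp only [esize_int]
  omega

theorem esize_le_of_natAbs_le {a b : ℤ} (h : a.natAbs ≤ b.natAbs) : esize a ≤ esize b := by
  have h1 := Nat.size_le_size h
  simp only [esize_int]
  omega

theorem esize_neg (a : ℤ) : esize (-a) = esize a := by simp [esize_int]

theorem PolyComp.add {f g : α → ℤ} (hf : PolyComp f) (hg : PolyComp g) :
    PolyComp (fun a => f a + g a) := by
  have h : PolyComp (fun p : ℤ × ℤ => p.1 + p.2) :=
    .of_op .add 0 (fun _ => rfl) fun p => by
      have := esize_add_le p.1 p.2
      rw [esize_prod]; omega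
  exact h.comp (hf.prodMk hg)

theorem PolyComp.sub {f g : α → ℤ} (hf : PolyComp f) (hg : PolyComp g) :
    PolyComp (fun a => f a - g a) := by
  have h : PolyComp (fun p : ℤ × ℤ => p.1 - p.2) :=
    .of_op .sub 0 (fun _ => rfl) fun p => by
      have := esize_add_le p.1 (-p.2)
      rw [esize_neg, ← sub_eq_add_neg] at this
      rw [esize_prod]; omega
  exact h.comp (hf.prodMk hg)

theorem PolyComp.mul {f g : α → ℤ} (hf : PolyComp f) (hg : PolyComp g) :
    PolyComp (fun a => f a * g a) := by
  have h : PolyComp (fun p : ℤ × ℤ => p.1 * p.2) :=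
    .of_op .mul 0 (fun _ => rfl) fun p => by
      have := size_mul_le p.1.natAbs p.2.natAbs
      simp only [esize_prod, esize_int, Int.natAbs_mul]
      omega
  exact h.comp (hf.prodMk hg)

theorem PolyComp.div {f g : α → ℤ} (hf : PolyComp f) (hg : PolyComp g) :
    PolyComp (fun a => f a / g a) := by
  have h : PolyComp (fun p : ℤ × ℤ => p.1 / p.2) :=
    .of_op .div 0 (fun _ => rfl) fun p => by
      have := Nat.size_le_size (Int.natAbs_ediv_le_natAbs p.1 p.2)
      simp only [esize_prod, esize_int]
      omega
  exact h.comp (hf.prodMk hg)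

attribute [fun_prop] PolyComp.add PolyComp.sub PolyComp.mul PolyComp.div

@[fun_prop]
theorem PolyComp.neg {f : α → ℤ} (hf : PolyComp f) : PolyComp (fun a => -f a) :=
  (PolyComp.sub (.const (0 : ℤ)) hf).of_enc fun a => by rw [zero_sub]

@[fun_prop]
theorem PolyComp.decide_lt {f g : α → ℤ} (hf : PolyComp f) (hg : PolyComp g) :
    PolyComp (fun a => decide (f a < g a)) := by
  refine (PolyComp.cond_of_isTrue (c := fun a => decide (f a < g a)) (hg.sub hf) (fun a => ?_)
    (.const true) (.const false)).of_enc fun a => by cases decide (f a < g a) <;> rfl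
  simp [Enc.enc, Val.IsTrue]

@[fun_prop]
theorem PolyComp.decide_le {f g : α → ℤ} (hf : PolyComp f) (hg : PolyComp g) :
    PolyComp (fun a => decide (f a ≤ g a)) :=
  (hg.decide_lt hf).not.of_enc fun a => by simp [← decide_not]

@[fun_prop]
theorem PolyComp.decide_eq {f g : α → ℤ} (hf : PolyComp f) (hg : PolyComp g) :
    PolyComp (fun a => decide (f a = g a)) :=
  ((hf.decide_le hg).and (hg.decide_le hf)).of_enc fun a => by
    simp only [le_antisymm_iff, Bool.decide_and]

@[fun_prop]
theorem PolyComp.natCast {f : α → ℕ} (hf : PolyComp f) : PolyComp (fun a => (f a : ℤ)) :=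
  hf.of_enc fun _ => rfl

@[fun_prop]
theorem PolyComp.decide_nat_eq {f g : α → ℕ} (hf : PolyComp f) (hg : PolyComp g) :
    PolyComp (fun a => decide (f a = g a)) :=
  (hf.natCast.decide_eq hg.natCast).of_enc fun a => by simp

@[fun_prop]
theorem PolyComp.succ {f : α → ℕ} (hf : PolyComp f) : PolyComp (fun a => f a + 1) :=
  (hf.natCast.add (.const (1 : ℤ))).of_enc fun _ => by simp [Enc.enc]

@[fun_prop]
theorem PolyComp.min {f g : α → ℤ} (hf : PolyComp f) (hg : PolyComp g) :
    PolyComp (fun a => min (f a) (g a)) :=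
  (PolyComp.cond (hf.decide_le hg) hf hg).of_enc fun a => by
    by_cases h : f a ≤ g a
    · simp [h]
    · simp [h, le_of_not_ge h]

@[fun_prop]
theorem PolyComp.max {f g : α → ℤ} (hf : PolyComp f) (hg : PolyComp g) :
    PolyComp (fun a => max (f a) (g a)) :=
  (PolyComp.cond (hf.decide_le hg) hg hf).of_enc fun a => by
    by_cases h : f a ≤ g a
    · simp [h]
    · simp [h, le_of_not_ge h]

end Arithmetic

/-! ### Folds and the list operations derived from them. -/

section Lists

variable {α β γ δ : Type*} [Enc α] [Enc β] [Enc γ] [Enc δ]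

@[fun_prop]
theorem PolyComp.cons {f : α → β} {g : α → List β} (hf : PolyComp f) (hg : PolyComp g) :
    PolyComp (fun a => f a :: g a) :=
  (hf.prodMk hg).of_enc fun _ => rfl

/-- Folding over a list, if the accumulator stays polynomially bounded. -/
theorem PolyComp.foldl_of_prefix {f : α → β → γ → β} {l : α → List γ} {b : α → β}
    (hf : PolyComp (fun p : α × β × γ => f p.1 p.2.1 p.2.2)) (hl : PolyComp l) (hb : PolyComp b)
    (hq : ∃ q : Polynomial ℕ, ∀ a, ∀ l', l' <+: l a →
      esize (l'.foldl (f a) (b a)) ≤ q.eval (esize a)) :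
    PolyComp (fun a => (l a).foldl (f a) (b a)) := by
  obtain ⟨q, hq⟩ := hq
  obtain ⟨F, pF, hF⟩ := hf
  have hinit : PolyComp (fun a => (l a, a, b a)) := by fun_prop
  obtain ⟨I, pI, hI⟩ := hinit
  obtain ⟨pl, hpl⟩ := hl.polyBdd
  -- one step of the loop on a state `(c :: l, a, b)`
  have harg : PolyComp (fun p : (γ × List γ) × α × β => (p.2.1, p.2.2, p.1.1)) := by fun_prop
  have hrest : PolyComp (fun p : (γ × List γ) × α × β => p.1.2) := by fun_prop
  have hctx : PolyComp (fun p : (γ × List γ) × α × β => p.2.1) := by fun_prop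
  obtain ⟨A, pA, hA⟩ := harg
  obtain ⟨R, pR, hR⟩ := hrest
  obtain ⟨C, pC, hC⟩ := hctx
  obtain ⟨E, pE, hE⟩ := (PolyComp.snd.comp PolyComp.snd : PolyComp (fun p : List γ × α × β => p.2.2))
  set test : Prog := .seq (.op .fst) (.op .isPair)
  set body : Prog := .pair R (.pair C (.seq A F))
  -- all states have size at most `S`
  set S : Polynomial ℕ := pl + Polynomial.X + q + 2
  set G : Polynomial ℕ := 2 * (pR + (2 * (pC + (pA + pF.comp pA + 1)) + Polynomial.X + 1))
    + Polynomial.X + 1 with hG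
  have hbody : ∀ (a : α) (b' : β) (c : γ) (l' : List γ),
      RunsIn body (Enc.enc (c :: l', a, b')) (Enc.enc (l', a, f a b' c))
        (G.eval (esize (c :: l', a, b'))) := by
    intro a b' c l'
    have h1 := hR ((c, l'), a, b')
    have h2 := hC ((c, l'), a, b')
    have h3 := hA ((c, l'), a, b')
    have h4 := hF (a, b', c)
    have h5 := polynomial_eval_mono pF h3.size_le
    refine (h1.pair (h2.pair (h3.seq h4))).mono ?_
    have e : esize (c :: l', a, b') = esize ((c, l'), a, b') := rfl
    simp only [hG, Polynomial.eval_add, Polynomial.eval_mul, Polynomial.eval_ofNat, Polynomial.eval_X,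
      Polynomial.eval_comp, Polynomial.eval_one, e]
    have e2 : (Enc.enc ((c, l'), a, b')).size = esize ((c, l'), a, b') := rfl
    rw [e2]
    change pF.eval (esize (a, b', c)) ≤ _ at h5
    omega
  -- `N` dominates the size of every state still to come, so each of the `l'.length + 1` tests,
  -- together with its round, is charged the same amount.
  have hloop : ∀ (a : α) (b' : β) (l' : List γ) (N : ℕ),
      (∀ l₁, l₁ <+: l' → esize l' + esize a + esize (l₁.foldl (f a) b') + 2 ≤ N) →
      RunsIn (.loop test body) (Enc.enc (l', a, b')) (Enc.enc (([] : List γ), a, l'.foldl (f a) b'))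
        ((l'.length + 1) * (4 * N + 5 + G.eval N)) := by
    intro a b' l'
    induction l' generalizing b' with
    | nil =>
      intro N hN
      have h0 := hN [] (List.prefix_refl _)
      have ht : Runs test (Enc.enc (([] : List γ), a, b')) (.int 0) _ := .seq (.op .fst _) (.op .isPair _)
      refine ⟨_, ?_, .loopStop ht (by simp [Val.IsTrue])⟩
      have e : (Enc.enc (([] : List γ), a, b')).size = esize a + esize b' + 3 := by
        change esize (([] : List γ), a, b') = _
        simp only [esize_prod, esize_nil]; omega
      simp only [e, List.foldl_nil, esize_nil] at *
      have e1 : (Op.apply .fst (Enc.enc (([] : List γ), a, b'))).size = 1 := by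
        simp [Op.apply, Enc.enc, Val.ofList, Val.size]
      have e2 : (Op.apply .isPair (Op.apply .fst (Enc.enc (([] : List γ), a, b')))).size = 1 := by
        simp [Op.apply, Enc.enc, Val.ofList, Val.size]
      rw [e1, e2]
      simp only [List.length_nil, zero_add, one_mul]
      omega
    | cons c l' ih =>
      intro N hN
      have hs : esize (c :: l', a, b') ≤ N := by
        have := hN [] (List.nil_prefix)
        simp only [List.foldl_nil] at this
        simp only [esize_prod]
        omega
      have ih := ih (f a b' c) N (fun l₁ hl₁ => by
        have := hN (c :: l₁) (by simpa using hl₁)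
        rw [List.foldl_cons, esize_cons] at this
        omega)
      obtain ⟨k₁, hk₁, h₁⟩ := ih
      obtain ⟨k₂, hk₂, h₂⟩ := hbody a b' c l'
      have hk₃ := polynomial_eval_mono G hs
      have ht : Runs test (Enc.enc (c :: l', a, b')) (.int 1) _ := .seq (.op .fst _) (.op .isPair _)
      refine ⟨_, ?_, .loopStep ht (by simp [Val.IsTrue]) h₂ h₁⟩
      have e1 : (Op.apply .fst (Enc.enc (c :: l', a, b'))).size = esize (c :: l') := rfl
      have e2 : (Op.apply .isPair (Op.apply .fst (Enc.enc (c :: l', a, b')))).size = 2 := by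
        simp [Op.apply, Enc.enc, Val.ofList, Val.size]
      have e3 : esize (c :: l') ≤ esize (c :: l', a, b') := by rw [esize_prod]; dsimp only; omega
      have e4 : (Enc.enc (c :: l', a, b')).size = esize (c :: l', a, b') := rfl
      rw [e1, e2, e4, List.length_cons, add_one_mul (l'.length + 1)]
      omega
  refine ⟨.seq I (.seq (.loop test body) E),
    pI + ((pl + 1) * (4 * S + 5 + G.comp S) + pE.comp S + 1) + 1, fun a => ?_⟩
  have h1 := hloop a (b a) (l a) (S.eval (esize a)) (fun l₁ hl₁ => by
    have := hq a l₁ hl₁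
    have := hpl a
    simp only [S, Polynomial.eval_add, Polynomial.eval_X, Polynomial.eval_ofNat]
    omega)
  have h2 := hE (([] : List γ), a, (l a).foldl (f a) (b a))
  refine ((hI a).seq (h1.seq h2)).mono ?_
  have h3 : pE.eval (esize (([] : List γ), a, (l a).foldl (f a) (b a))) ≤ pE.eval (S.eval (esize a)) := by
    refine polynomial_eval_mono pE ?_
    have := hq a _ (List.prefix_refl _)
    have := hpl a
    have := esize_pos (l a)
    simp only [S, Polynomial.eval_add, Polynomial.eval_X, Polynomial.eval_ofNat, esize_prod, esize_nil]
    omega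
  have h4 : (l a).length + 1 ≤ pl.eval (esize a) + 1 :=
    Nat.add_le_add_right ((length_le_esize _).trans (hpl a)) 1
  clear_value S G
  have h5 := Nat.mul_le_mul_right (4 * S.eval (esize a) + 5 + G.eval (S.eval (esize a))) h4
  simp only [Polynomial.eval_add, Polynomial.eval_mul, Polynomial.eval_comp, Polynomial.eval_one,
    Polynomial.eval_ofNat]
  omega

/-- Folding over a list, if each step increases the accumulator by a polynomial amount. -/
theorem PolyComp.foldl {f : α → β → γ → β} {l : α → List γ} {b : α → β}
    (hf : PolyComp (fun p : α × β × γ => f p.1 p.2.1 p.2.2)) (hl : PolyComp l) (hb : PolyComp b)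
    (hq : ∃ q : Polynomial ℕ, ∀ a, ∀ c ∈ l a, ∀ b',
      esize (f a b' c) ≤ esize b' + q.eval (esize a)) :
    PolyComp (fun a => (l a).foldl (f a) (b a)) := by
  refine .foldl_of_prefix hf hl hb ?_
  obtain ⟨q, hq⟩ := hq
  obtain ⟨pl, hpl⟩ := hl.polyBdd
  obtain ⟨pb, hpb⟩ := hb.polyBdd
  refine ⟨pb + pl * q, fun a l' hl' => ?_⟩
  have H : ∀ (l' : List γ) (b' : β), (∀ c ∈ l', c ∈ l a) →
      esize (l'.foldl (f a) b') ≤ esize b' + l'.length * q.eval (esize a) := by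
    intro l'
    induction l' with
    | nil => intro b' _; simp
    | cons c l' ih =>
      intro b' h
      have h1 := ih (f a b' c) fun c' hc' => h c' (List.mem_cons_of_mem _ hc')
      have h2 := hq a c (h c (by simp)) b'
      rw [List.foldl_cons, List.length_cons, add_one_mul]
      omega
  have h1 := H l' (b a) fun c hc => hl'.subset hc
  have h2 := hpb a
  have h3 : l'.length ≤ pl.eval (esize a) :=
    (hl'.length_le.trans (length_le_esize _)).trans (hpl a)
  have h4 := Nat.mul_le_mul_right (q.eval (esize a)) h3
  simp only [Polynomial.eval_add, Polynomial.eval_mul]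
  omega

/-- A bound on `f a c` for all members `c` of the list `l a`. -/
theorem PolyComp.bdd_of_mem {f : α → γ → β} {l : α → List γ}
    (hf : PolyComp (fun p : α × γ => f p.1 p.2)) (hl : PolyComp l) :
    ∃ q : Polynomial ℕ, ∀ a, ∀ c ∈ l a, esize (f a c) ≤ q.eval (esize a) := by
  obtain ⟨q, hq⟩ := hf.polyBdd
  obtain ⟨pl, hpl⟩ := hl.polyBdd
  refine ⟨q.comp (Polynomial.X + pl + 1), fun a c hc => (hq (a, c)).trans ?_⟩
  rw [Polynomial.eval_comp]
  refine polynomial_eval_mono q ?_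
  have h1 := hpl a
  have h2 := esize_mem hc
  simp only [esize_prod, Polynomial.eval_add, Polynomial.eval_X, Polynomial.eval_one]
  omega

@[fun_prop]
theorem PolyComp.reverse {l : α → List β} (hl : PolyComp l) : PolyComp (fun a => (l a).reverse) := by
  have h : PolyComp (fun a => (l a).foldl (fun acc c => c :: acc) []) := by
    refine .foldl (f := fun _ acc c => c :: acc) (by fun_prop) hl (by fun_prop) ?_
    obtain ⟨q, hq⟩ := PolyComp.bdd_of_mem (f := fun _ c => c) (by fun_prop) hl
    refine ⟨q + 1, fun a c hc b' => ?_⟩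
    have := hq a c hc
    simp only [esize_cons, Polynomial.eval_add, Polynomial.eval_one]
    omega
  refine h.of_enc fun a => ?_
  simp

@[fun_prop]
theorem PolyComp.append {l l' : α → List β} (hl : PolyComp l) (hl' : PolyComp l') :
    PolyComp (fun a => l a ++ l' a) := by
  have h : PolyComp (fun a => (l a).reverse.foldl (fun acc c => c :: acc) (l' a)) := by
    refine .foldl (f := fun _ acc c => c :: acc) (by fun_prop) hl.reverse hl' ?_
    obtain ⟨q, hq⟩ := PolyComp.bdd_of_mem (f := fun _ c => c) (by fun_prop) hl.reverse
    refine ⟨q + 1, fun a c hc b' => ?_⟩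
    have := hq a c hc
    simp only [esize_cons, Polynomial.eval_add, Polynomial.eval_one]
    omega
  refine h.of_enc fun a => ?_
  simp

theorem PolyComp.map {f : α → γ → β} {l : α → List γ}
    (hf : PolyComp (fun p : α × γ => f p.1 p.2)) (hl : PolyComp l) :
    PolyComp (fun a => (l a).map (f a)) := by
  have h : PolyComp (fun a => ((l a).foldl (fun acc c => f a c :: acc) []).reverse) := by
    refine .reverse (.foldl (f := fun a acc c => f a c :: acc) ?_ hl (by fun_prop) ?_)
    · exact .cons (hf.comp (by fun_prop : PolyComp fun p : α × List β × γ => (p.1, p.2.2)))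
        (by fun_prop)
    obtain ⟨q, hq⟩ := PolyComp.bdd_of_mem hf hl
    refine ⟨q + 1, fun a c hc b' => ?_⟩
    have := hq a c hc
    simp only [esize_cons, Polynomial.eval_add, Polynomial.eval_one]
    omega
  refine h.of_enc fun a => ?_
  congr 1
  have H : ∀ (l : List γ) (acc : List β), l.foldl (fun acc c => f a c :: acc) acc
      = (l.map (f a)).reverse ++ acc := by
    intro l
    induction l with
    | nil => simp
    | cons c l ih => intro acc; simp [ih]
  simp [H]

theorem PolyComp.filter {f : α → γ → Bool} {l : α → List γ}
    (hf : PolyComp (fun p : α × γ => f p.1 p.2)) (hl : PolyComp l) :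
    PolyComp (fun a => (l a).filter (f a)) := by
  have h : PolyComp (fun a => ((l a).foldl (fun acc c => bif f a c then c :: acc else acc) []).reverse) := by
    refine .reverse (.foldl (f := fun a acc c => bif f a c then c :: acc else acc) ?_ hl
      (by fun_prop) ?_)
    · exact .cond (hf.comp (by fun_prop : PolyComp fun p : α × List γ × γ => (p.1, p.2.2)))
        (by fun_prop) (by fun_prop)
    obtain ⟨q, hq⟩ := PolyComp.bdd_of_mem (f := fun _ c => c) (by fun_prop) hl
    refine ⟨q + 1, fun a c hc b' => ?_⟩
    have := hq a c hc
    simp only [Polynomial.eval_add, Polynomial.eval_one]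
    cases f a c <;> simp only [cond_true, cond_false, esize_cons] <;> omega
  refine h.of_enc fun a => ?_
  congr 1
  have H : ∀ (l : List γ) (acc : List γ), l.foldl (fun acc c => bif f a c then c :: acc else acc) acc
      = (l.filter (f a)).reverse ++ acc := by
    intro l
    induction l with
    | nil => simp
    | cons c l ih => intro acc; cases hc : f a c <;> simp [ih, hc]
  simp [H]

theorem PolyComp.all {f : α → γ → Bool} {l : α → List γ}
    (hf : PolyComp (fun p : α × γ => f p.1 p.2)) (hl : PolyComp l) :
    PolyComp (fun a => (l a).all (f a)) := by
  have h : PolyComp (fun a => (l a).foldl (fun acc c => acc && f a c) true) := by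
    refine .foldl (f := fun a acc c => acc && f a c) ?_ hl (by fun_prop) ⟨2, fun a c hc b' => ?_⟩
    · exact .and (by fun_prop)
        (hf.comp (by fun_prop : PolyComp fun p : α × Bool × γ => (p.1, p.2.2)))
    · have := esize_bool (b' && f a c)
      simp only [Polynomial.eval_ofNat]
      omega
  refine h.of_enc fun a => ?_
  congr 1
  have H : ∀ (l : List γ) (acc : Bool), l.foldl (fun acc c => acc && f a c) acc
      = (acc && l.all (f a)) := by
    intro l
    induction l with
    | nil => simp
    | cons c l ih => intro acc; simp [ih, Bool.and_assoc]
  simp [H]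

theorem PolyComp.any {f : α → γ → Bool} {l : α → List γ}
    (hf : PolyComp (fun p : α × γ => f p.1 p.2)) (hl : PolyComp l) :
    PolyComp (fun a => (l a).any (f a)) :=
  (PolyComp.all (f := fun a c => !f a c) hf.not hl).not.of_enc fun a => by
    rw [List.any_eq_not_all_not]

theorem PolyComp.sum {l : α → List ℤ} (hl : PolyComp l) : PolyComp (fun a => (l a).sum) := by
  have h : PolyComp (fun a => (l a).foldl (fun acc c => acc + c) 0) := by
    refine .foldl (f := fun _ acc c => acc + c) (by fun_prop) hl (by fun_prop) ?_
    obtain ⟨q, hq⟩ := PolyComp.bdd_of_mem (f := fun _ c => c) (by fun_prop) hl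
    refine ⟨q, fun a c hc b' => ?_⟩
    have := hq a c hc
    have := esize_add_le b' c
    omega
  refine h.of_enc fun a => ?_
  rw [List.sum_eq_foldl]

attribute [fun_prop] PolyComp.sum

theorem PolyComp.foldl_min {l : α → List ℤ} {b : α → ℤ} (hl : PolyComp l) (hb : PolyComp b) :
    PolyComp (fun a => (l a).foldl Min.min (b a)) := by
  refine .foldl (f := fun _ acc c => Min.min acc c) (by fun_prop) hl hb ?_
  obtain ⟨q, hq⟩ := PolyComp.bdd_of_mem (f := fun _ c => c) (by fun_prop) hl
  refine ⟨q, fun a c hc b' => ?_⟩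
  have := hq a c hc
  rcases min_choice b' c with h | h <;> rw [h] <;> omega

attribute [fun_prop] PolyComp.foldl_min

-- A fold carries a counter and overwrites the default when the counter meets the index.
@[fun_prop]
theorem PolyComp.getD {l : α → List β} {i : α → ℕ} {d : α → β} (hl : PolyComp l) (hi : PolyComp i)
    (hd : PolyComp d) : PolyComp (fun a => (l a).getD (i a) (d a)) := by
  have h : PolyComp (fun a => ((l a).foldl
      (fun (acc : ℕ × β) c => (acc.1 + 1, bif decide (acc.1 = i a) then c else acc.2)) (0, d a)).2) := by
    refine PolyComp.snd.comp (.foldl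
      (f := fun a (acc : ℕ × β) c => (acc.1 + 1, bif decide (acc.1 = i a) then c else acc.2))
      (by fun_prop) hl (by fun_prop) ?_)
    obtain ⟨q, hq⟩ := PolyComp.bdd_of_mem (f := fun _ c => c) (by fun_prop) hl
    refine ⟨q + 2, fun a c hc b' => ?_⟩
    have h1 := hq a c hc
    have h2 := size_add_le b'.1 1
    simp only [esize_prod, esize_nat, Polynomial.eval_add, Polynomial.eval_ofNat, Nat.size_one] at *
    cases decide (b'.1 = i a) <;> simp only [cond_true, cond_false] <;> omega
  refine h.of_enc fun a => ?_
  congr 1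
  have H : ∀ (l : List β) (k j : ℕ) (d : β), (l.foldl (fun (acc : ℕ × β) c =>
      (acc.1 + 1, bif decide (acc.1 = j) then c else acc.2)) (k, d)).2
      = if j < k then d else l.getD (j - k) d := by
    intro l
    induction l with
    | nil => intro k j d; simp
    | cons c l ih =>
      intro k j d
      rw [List.foldl_cons, ih]
      rcases lt_trichotomy j k with h | h | h
      · simp [h, show j < k + 1 by omega, show k ≠ j by omega]
      · simp [h]
      · obtain ⟨e, rfl⟩ : ∃ e, j = k + 1 + e := ⟨j - (k + 1), by omega⟩
        simp [show ¬ k + 1 + e < k by omega, show k + 1 + e - k = e + 1 by omega,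
          show ¬ k + 1 + e ≤ k by omega, show k ≠ k + 1 + e by omega]
  simp [H]

theorem esize_range_le (n : ℕ) : esize (List.range n) ≤ n * (n + 3) + 1 := by
  have h := esize_le_of_forall (l := List.range n) (B := n + 2) fun a ha => by
    have h1 : a < n := List.mem_range.1 ha
    have h2 : Nat.size a ≤ a := Nat.size_le.2 Nat.lt_two_pow_self
    rw [esize_nat]
    omega
  simpa using h

/-- The indices of the entries of a list. -/
@[fun_prop]
theorem PolyComp.range_length {l : α → List β} (hl : PolyComp l) :
    PolyComp (fun a => List.range (l a).length) := by
  have H : ∀ l : List β, l.foldl (fun (acc : ℕ × List ℕ) _ => (acc.1 + 1, acc.1 :: acc.2)) (0, [])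
      = (l.length, (List.range l.length).reverse) := by
    intro l
    induction l using List.reverseRecOn with
    | nil => simp
    | append_singleton l c ih => simp [ih, List.range_succ]
  have h : PolyComp (fun a => ((l a).foldl
      (fun (acc : ℕ × List ℕ) _ => (acc.1 + 1, acc.1 :: acc.2)) (0, [])).2.reverse) := by
    -- Each step adds the counter to the list, so the increment depends on the accumulator; the
    -- bound is therefore given for prefixes directly.
    refine .reverse (PolyComp.snd.comp (.foldl_of_prefix
      (f := fun _ (acc : ℕ × List ℕ) _ => (acc.1 + 1, acc.1 :: acc.2))
      (by fun_prop) hl (by fun_prop) ?_))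
    obtain ⟨pl, hpl⟩ := hl.polyBdd
    refine ⟨pl + (pl * (pl + 3) + 1) + 2, fun a l' hl' => ?_⟩
    have h1 : l'.length ≤ pl.eval (esize a) :=
      (hl'.length_le.trans (length_le_esize _)).trans (hpl a)
    have h2 := esize_range_le l'.length
    have h3 : Nat.size l'.length ≤ l'.length := Nat.size_le.2 Nat.lt_two_pow_self
    have h4 := Nat.mul_le_mul h1 (Nat.add_le_add_right h1 3)
    rw [H, esize_prod, esize_reverse, esize_nat]
    simp only [Polynomial.eval_add, Polynomial.eval_mul, Polynomial.eval_one, Polynomial.eval_ofNat]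
    omega
  refine h.of_enc fun a => ?_
  simp [H]

end Lists

end WhileLang

/-! ## Reachability in integer systems with unit coefficients -/

/-- A system `a x ≥ b`, `0 ≤ x ≤ d` with integer data. -/
structure IntSys (κ ι : Type*) where
  a : κ → ι → ℤ
  b : κ → ℤ
  d : ℤ

namespace IntSys

variable {κ ι : Type*} [Fintype ι] (S : IntSys κ ι)

/-- `x` is a solution of the system. -/
def Feas (x : ι → ℤ) : Prop :=
  (∀ j, 0 ≤ x j ∧ x j ≤ S.d) ∧ ∀ i, S.b i ≤ ∑ j, S.a i j * x j

/-- Solutions that differ in at most one coordinate. -/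
def Step (x y : ι → ℤ) : Prop := S.Feas x ∧ S.Feas y ∧ ∃ j, ∀ k, k ≠ j → x k = y k

/-- Solutions in the same component of the solution graph. -/
def Joined (x y : ι → ℤ) : Prop := S.Feas x ∧ S.Feas y ∧ Relation.ReflTransGen S.Step x y

variable {S}

theorem Step.symm {x y : ι → ℤ} (h : S.Step x y) : S.Step y x :=
  ⟨h.2.1, h.1, h.2.2.imp fun _ hj k hk => (hj k hk).symm⟩

theorem Joined.refl {x : ι → ℤ} (h : S.Feas x) : S.Joined x x := ⟨h, h, .refl⟩

theorem Joined.symm {x y : ι → ℤ} (h : S.Joined x y) : S.Joined y x := by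
  refine ⟨h.2.1, h.1, ?_⟩
  have := h.2.2
  induction this with
  | refl => exact .refl
  | tail hxy hyz ih =>
    exact .head hyz.symm (ih ⟨h.1, hyz.1, hxy⟩)

theorem Joined.trans {x y z : ι → ℤ} (h : S.Joined x y) (h' : S.Joined y z) : S.Joined x z :=
  ⟨h.1, h'.2.1, h.2.2.trans h'.2.2⟩

theorem Step.joined {x y : ι → ℤ} (h : S.Step x y) : S.Joined x y := ⟨h.1, h.2.1, .single h⟩

theorem Joined.induction {s : ι → ℤ} {C : (ι → ℤ) → Prop} (hs : C s)
    (hstep : ∀ x y, S.Joined s x → S.Step x y → C x → C y) {t : ι → ℤ} (h : S.Joined s t) : C t := by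
  obtain ⟨h1, h2, h⟩ := h
  induction h with
  | refl => exact hs
  | tail hxy hyz ih => exact hstep _ _ ⟨h1, hyz.1, hxy⟩ hyz (ih hyz.1)

/-- Coordinatewise maps that preserve feasibility along a path map it to a path. -/
theorem Joined.map {s t : ι → ℤ} (g : ι → ℤ → ℤ)
    (hg : ∀ x, S.Joined s x → S.Feas fun j => g j (x j)) (h : S.Joined s t) :
    S.Joined (fun j => g j (s j)) (fun j => g j (t j)) := by
  have hs := h.1
  refine Joined.induction (C := fun t => S.Joined (fun j => g j (s j)) (fun j => g j (t j)))
    (.refl (hg s (.refl hs))) (fun x y hx hxy ih => ih.trans (Step.joined ⟨ih.2.1, ?_, ?_⟩)) h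
  · exact hg y (hx.trans hxy.joined)
  · obtain ⟨j, hj⟩ := hxy.2.2
    exact ⟨j, fun k hk => by dsimp only; rw [hj k hk]⟩

/-- All coefficients are `0`, `1` or `-1`. -/
def IsUnit (S : IntSys κ ι) : Prop := ∀ i j, S.a i j = 0 ∨ S.a i j = 1 ∨ S.a i j = -1

/-- A half-integral optimal solution of the index program, shifted to `{-1, 0, 1}`: in each row
there is either at most one literal of weight `1` and no other literal of positive weight, or there
are at most two literals of weight `1/2`. -/
structure IsLabeling (S : IntSys κ ι) (ε : ι → ℤ) : Prop where
  val : ∀ j, ε j = 0 ∨ ε j = 1 ∨ ε j = -1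
  head : ∀ i j k, j ≠ k → S.a i j * ε j = 1 → S.a i k ≠ 0 → S.a i k * ε k = -1
  two : ∀ i, (Finset.univ.filter fun j => S.a i j ≠ 0 ∧ ε j = 0).card ≤ 2

/-- A linear form with coefficients `0, ±1`, at most two of them nonzero. -/
theorem exists_two_terms [Nonempty ι] (c : ι → ℤ) (hc : ∀ j, c j = 0 ∨ c j = 1 ∨ c j = -1)
    (h2 : (Finset.univ.filter fun j => c j ≠ 0).card ≤ 2) :
    ∃ p q e f, (e = 0 ∨ e = 1 ∨ e = -1) ∧ (f = 0 ∨ f = 1 ∨ f = -1) ∧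
      ∀ w : ι → ℤ, ∑ j, c j * w j = e * w p + f * w q := by
  classical
  have hsum : ∀ w : ι → ℤ, ∑ j, c j * w j = ∑ j with c j ≠ 0, c j * w j := fun w => by
    rw [Finset.sum_filter]
    refine Finset.sum_congr rfl fun j _ => ?_
    by_cases h : c j = 0 <;> simp [h]
  simp only [hsum]
  obtain ⟨j₀⟩ := ‹Nonempty ι›
  generalize (Finset.univ.filter fun j => c j ≠ 0) = T at *
  interval_cases h : T.card
  · rw [Finset.card_eq_zero] at h
    exact ⟨j₀, j₀, 0, 0, by simp, by simp, by simp [h]⟩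
  · obtain ⟨p, rfl⟩ := Finset.card_eq_one.1 h
    exact ⟨p, p, c p, 0, hc p, by simp, by simp⟩
  · obtain ⟨p, q, hpq, rfl⟩ := Finset.card_eq_two.1 h
    exact ⟨p, q, c p, c q, hc p, hc q, fun w => Finset.sum_pair hpq⟩

/-- Feasibility of a vector that is composed from feasible vectors: only rows with two unknowns
have to be considered. -/
theorem IsLabeling.feas_of_two [Nonempty ι] {ε : ι → ℤ} (hε : S.IsLabeling ε) (hu : S.IsUnit)
    {s t x x' y : ι → ℤ} (hs : S.Feas s) (ht : S.Feas t) (hx : S.Feas x) (hx' : S.Feas x')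
    (hst : ∀ j, ε j ≠ 0 → s j = t j) (hlx : ∀ j, ε j ≠ 0 → ε j * s j ≤ ε j * x j)
    (hlx' : ∀ j, ε j ≠ 0 → ε j * s j ≤ ε j * x' j) (hy : ∀ j, ε j ≠ 0 → y j = s j)
    (hbox : ∀ j, min (s j) (t j) ≤ y j ∧ y j ≤ max (s j) (t j))
    (htwo : ∀ e f B : ℤ, ∀ j k : ι, (e = 0 ∨ e = 1 ∨ e = -1) → (f = 0 ∨ f = 1 ∨ f = -1) →
      B ≤ e * s j + f * s k → B ≤ e * t j + f * t k → B ≤ e * x j + f * x k →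
      B ≤ e * x' j + f * x' k → B ≤ e * y j + f * y k) : S.Feas y := by
  classical
  refine ⟨fun j => ?_, fun i => ?_⟩
  · have h1 := hs.1 j
    have h2 := ht.1 j
    have h3 := hbox j
    omega
  -- A row with a head contains labelled coordinates only, and there `y` agrees with `s`.
  by_cases h : ∃ j, S.a i j * ε j = 1
  · obtain ⟨j, hj⟩ := h
    have : ∑ k, S.a i k * y k = ∑ k, S.a i k * s k := by
      refine Finset.sum_congr rfl fun k _ => ?_
      by_cases hk : S.a i k = 0
      · simp [hk]
      rw [hy]
      by_cases hjk : j = k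
      · subst hjk; rintro h0; simp [h0] at hj
      · have := hε.head i j k hjk hj hk
        rintro h0; simp [h0] at this
    rw [this]
    exact hs.2 i
  push Not at h
  -- Without a head, every labelled coordinate enters the row with `S.a i j * ε j ≤ 0`. Its
  -- contribution is therefore largest at `s`, where `ε j * x j` is least; `H` is the total of these
  -- largest contributions.
  set c : ι → ℤ := fun j => if ε j = 0 then S.a i j else 0 with hc
  set H : ℤ := ∑ j, (if ε j = 0 then 0 else S.a i j * s j) with hH
  have hsplit : ∀ w : ι → ℤ, ∑ j, S.a i j * w j
      = ∑ j, c j * w j + ∑ j, (if ε j = 0 then 0 else S.a i j * w j) := fun w => by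
    rw [← Finset.sum_add_distrib]
    refine Finset.sum_congr rfl fun j _ => ?_
    by_cases hj : ε j = 0 <;> simp [hc, hj]
  have hle : ∀ w : ι → ℤ, (∀ j, ε j ≠ 0 → ε j * s j ≤ ε j * w j) →
      ∑ j, (if ε j = 0 then 0 else S.a i j * w j) ≤ H := fun w hw => by
    refine Finset.sum_le_sum fun j _ => ?_
    by_cases hj : ε j = 0
    · simp [hj]
    · have h1 := hw j hj
      have h2 := h j
      simp only [hj, if_false]
      rcases hε.val j with h3 | h3 | h3
      · exact absurd h3 hj
      all_goals rcases hu i j with h4 | h4 | h4 <;> (simp [h3, h4] at h1 h2 ⊢; try omega)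
  obtain ⟨p, q, e, f, he, hf, hL⟩ := exists_two_terms c (fun j => by
      by_cases hj : ε j = 0 <;> simp only [hc, hj, if_true, if_false]
      · exact hu i j
      · simp) (by
      refine le_trans (Finset.card_le_card fun j hj => ?_) (hε.two i)
      by_cases h0 : ε j = 0 <;> simp_all)
  have key : ∀ w : ι → ℤ, S.Feas w → (∀ j, ε j ≠ 0 → ε j * s j ≤ ε j * w j) →
      S.b i - H ≤ e * w p + f * w q := fun w hw hlw => by
    have h1 := hw.2 i
    have h2 := hle w hlw
    rw [hsplit, hL] at h1
    omega
  have hy' := htwo e f (S.b i - H) p q he hf (key s hs fun j _ => le_rfl)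
    (key t ht fun j hj => by rw [hst j hj]) (key x hx hlx) (key x' hx' hlx')
  have : ∑ j, (if ε j = 0 then 0 else S.a i j * y j) = H :=
    Finset.sum_congr rfl fun j _ => by
      by_cases hj : ε j = 0
      · simp [hj]
      · simp [hj, hy j hj]
  rw [hsplit, hL, this]
  omega

/-! ### Truncating and translating solutions of rows with two unknowns. -/

section Two

/-- The projection of `x` to the interval between `s` and the point that is reached from `s` by
moving by at most `r` towards `t`. -/
def clamp (r s t x : ℤ) : ℤ :=
  if t ≤ s then max (s - r) (max t (min s x)) else min (s + r) (min t (max s x))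

/-- The translate by `r` of the projection of `x` to the interval between `s` and the point that is
reached from `s` by moving by at most `1` towards `t`. -/
def shift (r s t x : ℤ) : ℤ :=
  if t ≤ s then (if r < s - t then clamp 1 s t x - r else t)
  else (if r < t - s then clamp 1 s t x + r else t)

/-- Projecting `x` to the interval between `s` and `t` takes the median of `s`, `t`, `x`, and
medians preserve constraints in two variables. Clipping the deviations from `s` to `[-r, r]` then
gives a row value no smaller than the lesser of those at `s` and at the median, because the nonzero
coefficients are `±1`. -/
theorem clamp_two {r e f B s s' t t' x x' : ℤ} (hr : 0 ≤ r) (he : e = 0 ∨ e = 1 ∨ e = -1)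
    (hf : f = 0 ∨ f = 1 ∨ f = -1) (hs : B ≤ e * s + f * s') (ht : B ≤ e * t + f * t')
    (hx : B ≤ e * x + f * x') : B ≤ e * clamp r s t x + f * clamp r s' t' x' := by
  unfold clamp
  rcases he with rfl | rfl | rfl <;> rcases hf with rfl | rfl | rfl <;>
    simp only [zero_mul, one_mul, neg_mul, zero_add, add_zero] at * <;>
    omega

/-- If both coordinates still move and their effects on the row are opposite, the translations
cancel and the value is that at the first unit step. If both effects lower the row, `t` gives the
bound; if both raise it, `s` does. A coordinate already settled at `t` has moved by at most `r`, one
still moving by at least `r`, so again `s` or `t` gives the bound. -/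
theorem shift_two {r e f B s s' t t' x x' : ℤ} (hr : 0 ≤ r) (he : e = 0 ∨ e = 1 ∨ e = -1)
    (hf : f = 0 ∨ f = 1 ∨ f = -1) (hs : B ≤ e * s + f * s') (ht : B ≤ e * t + f * t')
    (hx : B ≤ e * x + f * x') : B ≤ e * shift r s t x + f * shift r s' t' x' := by
  have h := clamp_two (r := 1) (by norm_num) he hf hs ht hx
  have h1 : ∀ s t x, if t ≤ s then max (s - 1) t ≤ clamp 1 s t x ∧ clamp 1 s t x ≤ s else
      s ≤ clamp 1 s t x ∧ clamp 1 s t x ≤ min (s + 1) t := by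
    intro s t x; unfold clamp; split_ifs <;> omega
  have h2 := h1 s t x
  have h3 := h1 s' t' x'
  unfold shift
  generalize clamp 1 s t x = y at *
  generalize clamp 1 s' t' x' = y' at *
  clear h1 hx
  rcases he with rfl | rfl | rfl <;> rcases hf with rfl | rfl | rfl <;>
    simp only [zero_mul, one_mul, neg_mul, zero_add, add_zero] at * <;>
    first | omega | (split_ifs at * <;> omega)

variable [Nonempty ι] {ε : ι → ℤ} (hε : S.IsLabeling ε) (hu : S.IsUnit) {s t : ι → ℤ}
  (hs : S.Feas s) (ht : S.Feas t) (hst : ∀ j, ε j ≠ 0 → s j = t j)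

include hε hu hs ht hst

theorem IsLabeling.feas_clamp {r : ℤ} (hr : 0 ≤ r) {x : ι → ℤ} (hx : S.Feas x)
    (hlx : ∀ j, ε j ≠ 0 → ε j * s j ≤ ε j * x j) : S.Feas fun j => clamp r (s j) (t j) (x j) := by
  refine hε.feas_of_two hu hs ht hx hx hst hlx hlx (fun j hj => ?_) (fun j => ?_)
    fun e f B j k he hf h1 h2 h3 _ => clamp_two hr he hf h1 h2 h3
  · have := hst j hj
    unfold clamp; split_ifs <;> omega
  · unfold clamp; split_ifs <;> omega

theorem IsLabeling.feas_shift {r : ℤ} (hr : 0 ≤ r) {x : ι → ℤ} (hx : S.Feas x)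
    (hlx : ∀ j, ε j ≠ 0 → ε j * s j ≤ ε j * x j) : S.Feas fun j => shift r (s j) (t j) (x j) := by
  refine hε.feas_of_two hu hs ht hx hx hst hlx hlx (fun j hj => ?_) (fun j => ?_)
    fun e f B j k he hf h1 h2 h3 _ => shift_two hr he hf h1 h2 h3
  · have := hst j hj
    unfold shift clamp; split_ifs <;> omega
  · unfold shift clamp; split_ifs <;> omega

end Two

end IntSys

namespace IntSys

variable {κ ι : Type*} [Fintype ι] {S : IntSys κ ι}

/-! ### Truncated and translated paths. -/

section Two

variable [Nonempty ι] {ε : ι → ℤ} (hε : S.IsLabeling ε) (hu : S.IsUnit) {s t : ι → ℤ}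
  (hs : S.Feas s) (ht : S.Feas t) (hst : ∀ j, ε j ≠ 0 → s j = t j)
  (hlow : ∀ x, S.Joined s x → ∀ j, ε j ≠ 0 → ε j * s j ≤ ε j * x j)

include hε hu hs ht hst hlow

/-- A path from `s` to `t` is truncated to a path from `s` to a point close to `s`. -/
theorem IsLabeling.joined_clamp (h : S.Joined s t) {r : ℤ} (hr : 0 ≤ r) :
    S.Joined s fun j => clamp r (s j) (t j) (t j) := by
  have := h.map (fun j => clamp r (s j) (t j)) fun x hx =>
    hε.feas_clamp hu hs ht hst hr hx.2.1 (hlow x hx)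
  convert this using 1
  funext j
  unfold clamp; split_ifs <;> omega

/-- A path of the first unit step towards `t` is translated to a path of any other unit step. -/
theorem IsLabeling.joined_shift (h : S.Joined s fun j => clamp 1 (s j) (t j) (t j)) {r : ℤ}
    (hr : 0 ≤ r) : S.Joined (fun j => clamp r (s j) (t j) (t j))
      fun j => clamp (r + 1) (s j) (t j) (t j) := by
  have := h.map (fun j => shift r (s j) (t j)) fun x hx =>
    hε.feas_shift hu hs ht hst hr hx.2.1 (hlow x hx)
  convert this using 1 <;> funext j <;> unfold shift clamp <;> split_ifs <;> omega

/-- The translates of the first unit step are concatenated. -/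
theorem IsLabeling.joined_of_joined_one (h : S.Joined s fun j => clamp 1 (s j) (t j) (t j)) :
    S.Joined s t := by
  have H : ∀ r : ℕ, S.Joined s fun j => clamp r (s j) (t j) (t j) := by
    intro r
    induction r with
    | zero =>
      have : (fun j => clamp ((0 : ℕ) : ℤ) (s j) (t j) (t j)) = s := by
        funext j; unfold clamp; split_ifs <;> omega
      rw [this]
      exact .refl hs
    | succ r ih =>
      have := hε.joined_shift hu hs ht hst hlow h (r := r) (by omega)
      exact_mod_cast ih.trans this
  -- This radius is at least every coordinate distance, so the clamp is `t` itself.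
  have := H (∑ j, (s j - t j).natAbs)
  convert this using 1
  funext j
  have := Finset.single_le_sum (f := fun j => (s j - t j).natAbs) (fun _ _ => Nat.zero_le _)
    (Finset.mem_univ j)
  unfold clamp; split_ifs <;> omega

end Two

/-! ### The first unit step as a search over sets of moved coordinates. -/

section Boolean

variable [DecidableEq ι]

/-- The coordinates in `M` are moved by one towards `t`. -/
def moved (s t : ι → ℤ) (M : Finset ι) : ι → ℤ :=
  fun j => if j ∈ M then clamp 1 (s j) (t j) (t j) else s j

variable [Nonempty ι] {ε : ι → ℤ} (hε : S.IsLabeling ε) (hu : S.IsUnit) {s t : ι → ℤ}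
  (hs : S.Feas s) (ht : S.Feas t) (hst : ∀ j, ε j ≠ 0 → s j = t j)

include hε hu hs ht hst

/-- In a row with two unknowns the union looks like `X` or like `Y`, unless one coordinate is moved
only by `X` and the other only by `Y`. Then, if both moves lower the row, `t` has gone at least as
far in both; if they cancel or both raise it, the value is at least that at `s`. A move without
effect on the row leads back to `X` or `Y`. -/
theorem IsLabeling.feas_moved_union {X Y : Finset ι} (hX : S.Feas (moved s t X))
    (hY : S.Feas (moved s t Y)) : S.Feas (moved s t (X ∪ Y)) := by
  have h0 : ∀ X j, ε j ≠ 0 → moved s t X j = s j := fun X j hj => by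
    have := hst j hj
    unfold moved clamp; split_ifs <;> omega
  refine hε.feas_of_two hu hs ht hX hY hst (fun j hj => by rw [h0 X j hj])
    (fun j hj => by rw [h0 Y j hj]) (h0 _) (fun j => ?_) fun e f B j k he hf h1 h2 h3 h4 => ?_
  · unfold moved clamp; split_ifs <;> omega
  · simp only [moved, Finset.mem_union] at *
    have hc : ∀ j, (s j < t j ∧ clamp 1 (s j) (t j) (t j) = s j + 1) ∨
        (t j < s j ∧ clamp 1 (s j) (t j) (t j) = s j - 1) ∨
        (t j = s j ∧ clamp 1 (s j) (t j) (t j) = s j) := fun j => by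
      unfold clamp; split_ifs <;> omega
    have hj := hc j
    have hk := hc k
    by_cases m1 : j ∈ X <;> by_cases m2 : j ∈ Y <;> by_cases m3 : k ∈ X <;> by_cases m4 : k ∈ Y <;>
      simp only [m1, m2, m3, m4, or_true, or_false, if_true, if_false] at h3 h4 ⊢ <;>
      first
        | assumption
        | (rcases he with rfl | rfl | rfl <;> rcases hf with rfl | rfl | rfl <;>
            simp only [zero_mul, one_mul, neg_mul, zero_add, add_zero] at * <;> omega)

/-- If each coordinate in `Y` can be moved individually, they can be moved one after the other. -/
theorem IsLabeling.joined_moved_union {X : Finset ι} (hX : S.Joined s (moved s t X))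
    (Y : Finset ι) (hY : ∀ j ∈ Y, S.Feas (moved s t (insert j X))) :
    S.Joined s (moved s t (X ∪ Y)) := by
  induction Y using Finset.induction_on with
  | empty => simpa using hX
  | insert j Y hj ih =>
    have h1 := ih fun k hk => hY k (Finset.mem_insert_of_mem hk)
    refine h1.trans (Step.joined ⟨h1.2.1, ?_, j, fun k hk => ?_⟩)
    · have := hε.feas_moved_union hu hs ht hst h1.2.1 (hY j (by simp))
      convert this using 2
      ext k; simp only [Finset.mem_union, Finset.mem_insert]; tauto
    · simp [moved, hk]

/-- Along any path from `s`, the clamp to the first unit step records which coordinates have moved.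
Uniting this set with `M` shows that no coordinate outside `M` can be the first to join it. -/
theorem IsLabeling.joined_one_iff
    (hlow : ∀ x, S.Joined s x → ∀ j, ε j ≠ 0 → ε j * s j ≤ ε j * x j) {M : Finset ι}
    (hM : S.Joined s (moved s t M))
    (hclosed : ∀ j, s j ≠ t j → S.Feas (moved s t (insert j M)) → j ∈ M) :
    S.Joined s t ↔ ∀ j, s j ≠ t j → j ∈ M := by
  refine ⟨fun h => ?_, fun h => hε.joined_of_joined_one hu hs ht hst hlow ?_⟩
  · have H : ∀ x, S.Joined s x → ∀ j, clamp 1 (s j) (t j) (x j) ≠ s j → j ∈ M := by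
      intro x hx
      refine Joined.induction (C := fun x => ∀ j, clamp 1 (s j) (t j) (x j) ≠ s j → j ∈ M)
        (fun j hj => (hj ?_).elim) (fun x y hx hxy ih j hj => ?_) hx
      · unfold clamp; split_ifs <;> omega
      · obtain ⟨j₀, hj₀⟩ := hxy.2.2
        by_cases hjj : j = j₀
        · subst hjj
          refine hclosed j (fun h => hj ?_) ?_
          · unfold clamp; split_ifs <;> omega
          have hy := hε.feas_clamp hu hs ht hst (r := 1) (by norm_num) hxy.2.1
            (hlow y (hx.trans hxy.joined))
          have e : (fun j => clamp 1 (s j) (t j) (y j)) = moved s t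
              (Finset.univ.filter fun j => clamp 1 (s j) (t j) (y j) ≠ s j) := by
            funext k
            simp only [moved, Finset.mem_filter, Finset.mem_univ, true_and]
            unfold clamp; split_ifs <;> omega
          rw [e] at hy
          -- By the induction hypothesis all moved coordinates other than `j` lie in `M`, so this
          -- union is `insert j M`, and closedness of `M` applies.
          have := hε.feas_moved_union hu hs ht hst hM.2.1 hy
          convert this using 2
          ext k
          simp only [Finset.mem_union, Finset.mem_insert, Finset.mem_filter, Finset.mem_univ,
            true_and]
          constructor
          · rintro (rfl | hk)
            · exact .inr hj
            · exact .inl hk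
          · rintro (hk | hk)
            · exact .inr hk
            · by_cases hkj : k = j
              · exact .inl hkj
              · rw [← hj₀ k hkj] at hk
                exact .inr (ih k hk)
        · rw [← hj₀ j hjj] at hj
          exact ih j hj
    intro j hj
    refine H t h j ?_
    unfold clamp; split_ifs <;> omega
  · convert hM using 1
    funext j
    simp only [moved]
    by_cases hj : s j = t j
    · simp only [hj]; unfold clamp; split_ifs <;> omega
    · simp [h j hj]

end Boolean

/-! ### The least point of a component in the labelled coordinates. -/

section Descent

/-- The largest possible displacement of a coordinate in the direction given by the labeling. -/
def cap (S : IntSys κ ι) (ε s : ι → ℤ) (j : ι) : ℤ :=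
  if ε j = 1 then s j else if ε j = -1 then S.d - s j else 0

/-- The slack of a row. -/
def slack (S : IntSys κ ι) (s : ι → ℤ) (i : κ) : ℤ := ∑ k, S.a i k * s k - S.b i

/-- The bound that row `i` puts on the displacement of its head. -/
def cost (S : IntSys κ ι) (ε s : ι → ℤ) (z : ι → ℤ) (i : κ) : ℤ :=
  S.slack s i + ∑ k, if S.a i k * ε k = -1 then z k else 0

/-- The coordinates that can be moved at all: the least set that contains a coordinate with positive
capacity if all rows with this head have positive slack or a member of the set in their body. -/
def Active (S : IntSys κ ι) (ε s : ι → ℤ) (j : ι) : Prop :=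
  ∀ Q : ι → Prop, (∀ j, 0 < S.cap ε s j → (∀ i, S.a i j * ε j = 1 →
    0 < S.slack s i ∨ ∃ k, S.a i k * ε k = -1 ∧ Q k) → Q j) → Q j

theorem slack_nonneg {s : ι → ℤ} (hs : S.Feas s) (i : κ) : 0 ≤ S.slack s i :=
  sub_nonneg.2 (hs.2 i)

theorem cost_mono {ε s z z' : ι → ℤ} (h : ∀ j, z j ≤ z' j) (i : κ) :
    S.cost ε s z i ≤ S.cost ε s z' i := by
  unfold cost
  gcongr with k
  split_ifs
  · exact h k
  · exact le_rfl

variable {ε : ι → ℤ} (hε : S.IsLabeling ε) {s : ι → ℤ} (hs : S.Feas s)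

include hε hs

omit hε in
theorem cap_nonneg (j : ι) : 0 ≤ S.cap ε s j := by
  have := hs.1 j
  unfold cap; split_ifs <;> omega

/-- In a row with head `j` the descent lowers the value by `z j` and raises it by the displacements
of the body, so the new slack is the cost minus `z j`. In a row without a head no change is
negative. -/
theorem IsLabeling.feas_descent (hu : S.IsUnit) {z : ι → ℤ} (h0 : ∀ j, 0 ≤ z j)
    (hc : ∀ j, z j ≤ S.cap ε s j) (hz : ∀ i j, S.a i j * ε j = 1 → z j ≤ S.cost ε s z i) :
    S.Feas fun j => s j - ε j * z j := by
  classical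
  refine ⟨fun j => ?_, fun i => ?_⟩
  · have h1 := h0 j
    have h2 := hc j
    have h3 := hs.1 j
    unfold cap at h2
    rcases hε.val j with h | h | h <;> simp [h] at h2 ⊢ <;> omega
  have hval : ∀ k, S.a i k * ε k = 0 ∨ S.a i k * ε k = 1 ∨ S.a i k * ε k = -1 := fun k => by
    rcases hu i k with h | h | h <;> rcases hε.val k with h' | h' | h' <;> simp [h, h']
  have hsum : ∑ k, S.a i k * (s k - ε k * z k)
      = ∑ k, S.a i k * s k - ∑ k, S.a i k * ε k * z k := by
    rw [← Finset.sum_sub_distrib]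
    exact Finset.sum_congr rfl fun k _ => by ring
  rw [hsum]
  by_cases h : ∃ j, S.a i j * ε j = 1
  · obtain ⟨j, hj⟩ := h
    have h1 := hz i j hj
    have h2 : ∑ k, S.a i k * ε k * z k
        = z j - ∑ k, (if S.a i k * ε k = -1 then z k else 0) := by
      have : z j = ∑ k, if k = j then z k else 0 := by simp
      rw [this, ← Finset.sum_sub_distrib]
      refine Finset.sum_congr rfl fun k _ => ?_
      by_cases hk : k = j
      · subst hk; simp [hj]
      · by_cases ha : S.a i k = 0
        · simp [ha, hk]
        · simp [hε.head i j k (Ne.symm hk) hj ha, hk]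
    unfold cost slack at h1
    omega
  · push Not at h
    have h1 : ∑ k, S.a i k * ε k * z k ≤ 0 := by
      refine Finset.sum_nonpos fun k _ => ?_
      have h2 := h0 k
      rcases hval k with h3 | h3 | h3
      · simp [h3]
      · exact absurd h3 (h k)
      · rw [h3]; omega
    have := hs.2 i
    omega

variable {z : ι → ℤ} (h0 : ∀ j, 0 ≤ z j) (hc : ∀ j, z j ≤ S.cap ε s j)
  (hpre : ∀ j, z j = S.cap ε s j ∨ ∃ i, S.a i j * ε j = 1 ∧ S.cost ε s z i ≤ z j)
  (hpost : ∀ i j, S.a i j * ε j = 1 → z j ≤ S.cost ε s z i)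
  (hact : ∀ j, z j = 0 ∨ S.Active ε s j)

include h0 hc hpre hpost hact

omit hε hc in
/-- A vector below the fixed point in which no coordinate can be raised is the fixed point. -/
theorem eq_of_stuck {w : ι → ℤ} (hw0 : ∀ j, 0 ≤ w j) (hwz : ∀ j, w j ≤ z j)
    (hw : ∀ j, w j < z j → ∃ i, S.a i j * ε j = 1 ∧ S.cost ε s w i ≤ w j) : w = z := by
  classical
  by_contra hne
  have hle : ∀ (v : ι → ℤ), (∀ j, 0 ≤ v j) → ∀ i k, S.a i k * ε k = -1 →
      v k ≤ ∑ k, (if S.a i k * ε k = -1 then v k else 0) := fun v hv i k hk => by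
    have := Finset.single_le_sum (f := fun k => if S.a i k * ε k = -1 then v k else 0)
      (fun k _ => by split_ifs; exacts [hv k, le_rfl]) (Finset.mem_univ k)
    simpa [hk] using this
  -- Induction over the least set: a row with positive slack or a positive body member cannot block
  -- its head at displacement 0, neither for `z` nor for `w`.
  have hpos : ∀ j, S.Active ε s j → 0 < z j ∧ 0 < w j := by
    intro j hj
    refine hj (fun j => 0 < z j ∧ 0 < w j) fun j hj hrow => ?_
    have hz : 0 < z j := by
      rcases hpre j with h | ⟨i, hi, h⟩
      · omega
      · unfold cost at h
        have hsl := slack_nonneg hs i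
        rcases hrow i hi with h1 | ⟨k, hk, h1⟩
        · have : 0 ≤ ∑ k, (if S.a i k * ε k = -1 then z k else 0) :=
            Finset.sum_nonneg fun k _ => by split_ifs; exacts [h0 k, le_rfl]
          omega
        · have := hle z h0 i k hk
          omega
    refine ⟨hz, ?_⟩
    by_contra hwj
    obtain ⟨i, hi, h⟩ := hw j (by omega)
    unfold cost at h
    have hsl := slack_nonneg hs i
    rcases hrow i hi with h1 | ⟨k, hk, h1⟩
    · have : 0 ≤ ∑ k, (if S.a i k * ε k = -1 then w k else 0) :=
        Finset.sum_nonneg fun k _ => by split_ifs; exacts [hw0 k, le_rfl]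
      omega
    · have := hle w hw0 i k hk
      omega
  have hact' : ∀ j, w j < z j → S.Active ε s j := fun j hj =>
    (hact j).resolve_left (by have := hw0 j; omega)
  obtain ⟨j₁, hj₁⟩ : ∃ j, w j < z j := by
    by_contra! h
    exact hne (funext fun j => le_antisymm (hwz j) (h j))
  -- Among the coordinates that still have to rise, take one of least value. Induction over the
  -- active set excludes every coordinate of this value, hence also `j₀`.
  obtain ⟨j₀, hj₀, hmin⟩ := Finset.exists_min_image (Finset.univ.filter fun j => w j < z j) w
    ⟨j₁, by simpa using hj₁⟩
  simp only [Finset.mem_filter, Finset.mem_univ, true_and] at hj₀ hmin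
  suffices H : ∀ j, S.Active ε s j → 0 < w j ∧ ¬ (w j = w j₀ ∧ w j < z j) from
    (H j₀ (hact' j₀ hj₀)).2 ⟨rfl, hj₀⟩
  intro j hj
  refine ⟨(hpos j hj).2, ?_⟩
  suffices H : (S.Active ε s j ∧ ¬ (w j = w j₀ ∧ w j < z j)) from H.2
  -- The predicate carries activity along because positivity of an active body member is needed
  -- below.
  refine hj (fun j => S.Active ε s j ∧ ¬ (w j = w j₀ ∧ w j < z j)) fun j hcap hrow => ?_
  have hjact : S.Active ε s j := fun Q hQ => hQ j hcap fun i hi =>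
    (hrow i hi).imp_right fun ⟨k, hk, hk'⟩ => ⟨k, hk, hk'.1 Q hQ⟩
  refine ⟨hjact, fun ⟨hv, hlt⟩ => ?_⟩
  obtain ⟨i, hi, hcost⟩ := hw j hlt
  have hlt' : S.cost ε s w i < S.cost ε s z i := by have := hpost i j hi; omega
  obtain ⟨k, hk, hkz⟩ : ∃ k, S.a i k * ε k = -1 ∧ w k < z k := by
    by_contra! h
    refine absurd hlt' (not_lt.2 ?_)
    unfold cost
    gcongr with k
    split_ifs with hk
    · exact h k hk
    · exact le_rfl
  -- The blocking row has value at most `w j = w j₀ ≤ w k`, so `k` alone exhausts it: there is no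
  -- slack and no other positive body member. The justification of the activity of `j` by this row
  -- can then only be `k`, which the induction excludes.
  have hwk := hmin k hkz
  have hkle := hle w hw0 i k hk
  have hsl := slack_nonneg hs i
  unfold cost at hcost
  rcases hrow i hi with h1 | ⟨l, hl, hlact, hl'⟩
  · omega
  · by_cases hlk : l = k
    · subst hlk
      exact hl' ⟨by omega, hkz⟩
    · have h2 : w l + w k ≤ ∑ k, (if S.a i k * ε k = -1 then w k else 0) := by
        rw [← Finset.sum_pair (f := w) hlk]
        have : ∑ x ∈ {l, k}, w x = ∑ x ∈ {l, k}, (if S.a i x * ε x = -1 then w x else 0) := by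
          rw [Finset.sum_pair hlk, Finset.sum_pair hlk]; simp [hl, hk]
        rw [this]
        exact Finset.sum_le_sum_of_subset_of_nonneg (Finset.subset_univ _) fun x _ _ => by
          split_ifs; exacts [hw0 x, le_rfl]
      have := (hpos l hlact).2
      omega

/-- The fixed point is reached by unit steps. -/
theorem IsLabeling.joined_descent (hu : S.IsUnit) : S.Joined s fun j => s j - ε j * z j := by
  classical
  -- `N` bounds the total displacement still missing; each step raises one coordinate that no row
  -- blocks.
  suffices H : ∀ (N : ℕ) (w : ι → ℤ), (∀ j, 0 ≤ w j) → (∀ j, w j ≤ z j) →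
      ∑ j, (z j - w j) ≤ N → S.Joined s (fun j => s j - ε j * w j) →
      (∀ i j, S.a i j * ε j = 1 → w j ≤ S.cost ε s w i) → S.Joined s fun j => s j - ε j * z j by
    refine H (∑ j, (z j - 0)).toNat (fun _ => 0) (fun _ => le_rfl) h0 (Int.self_le_toNat _)
      (by simpa using Joined.refl hs) fun i j _ => ?_
    have := slack_nonneg hs i
    simpa [cost] using this
  intro N
  induction N with
  | zero =>
    intro w hw0 hwz hN hJ _
    have h1 : ∀ j ∈ Finset.univ, 0 ≤ z j - w j := fun j _ => sub_nonneg.2 (hwz j)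
    have h2 := (Finset.sum_eq_zero_iff_of_nonneg h1).1
      (le_antisymm (by exact_mod_cast hN) (Finset.sum_nonneg h1))
    have : w = z := funext fun j => by have := h2 j (Finset.mem_univ j); omega
    rwa [← this]
  | succ N ih =>
    intro w hw0 hwz hN hJ hwc
    by_cases hstuck : ∀ j, w j < z j → ∃ i, S.a i j * ε j = 1 ∧ S.cost ε s w i ≤ w j
    · rwa [← eq_of_stuck hs h0 hpre hpost hact hw0 hwz hstuck]
    push Not at hstuck
    obtain ⟨j, hj, hjc⟩ := hstuck
    set w' : ι → ℤ := Function.update w j (w j + 1) with hw'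
    have hww : ∀ k, w k ≤ w' k := fun k => by
      by_cases hk : k = j
      · subst hk; simp [hw']
      · simp [hw', hk]
    have hw'z : ∀ k, w' k ≤ z k := fun k => by
      by_cases hk : k = j
      · subst hk; simp [hw']; omega
      · simp [hw', hk, hwz]
    have hw'c : ∀ i k, S.a i k * ε k = 1 → w' k ≤ S.cost ε s w' i := fun i k hik => by
      refine le_trans ?_ (cost_mono hww i)
      by_cases hk : k = j
      · subst hk
        have := hjc i hik
        simp [hw']; omega
      · simpa [hw', hk] using hwc i k hik
    have hw'0 : ∀ k, 0 ≤ w' k := fun k => (hw0 k).trans (hww k)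
    refine ih w' hw'0 hw'z ?_ (hJ.trans (Step.joined ⟨hJ.2.1, ?_, j, fun k hk => ?_⟩)) hw'c
    · have : ∑ k, (z k - w' k) < ∑ k, (z k - w k) :=
        Finset.sum_lt_sum (fun k _ => sub_le_sub_left (hww k) _) ⟨j, Finset.mem_univ j, by
          simp [hw']⟩
      push_cast at hN
      omega
    · exact hε.feas_descent hs hu hw'0 (fun k => (hw'z k).trans (hc k)) hw'c
    · simp [hw', hk]

omit h0 hc hpost hact in
/-- No solution that is reachable from `s` is displaced further than the fixed point. -/
theorem IsLabeling.displacement_le (hu : S.IsUnit) (h0 : ∀ j, 0 ≤ z j) {x : ι → ℤ}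
    (hx : S.Joined s x) : ∀ j, ε j ≠ 0 → ε j * (s j - x j) ≤ z j := by
  classical
  refine Joined.induction (C := fun x => ∀ j, ε j ≠ 0 → ε j * (s j - x j) ≤ z j)
    (fun j _ => by simpa using h0 j) (fun x y hx hxy ih j hj => ?_) hx
  obtain ⟨j₀, hj₀⟩ := hxy.2.2
  by_cases hjj : j = j₀
  swap
  · rw [← hj₀ j hjj]
    exact ih j hj
  subst hjj
  have hy := hxy.2.1
  rcases hpre j with h | ⟨i, hi, h⟩
  · rw [h]
    have h1 := hy.1 j
    have h2 := hs.1 j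
    unfold cap
    rcases hε.val j with h3 | h3 | h3
    · exact absurd h3 hj
    · simp [h3]; omega
    · simp [h3]; omega
  · refine le_trans ?_ h
    have h1 := hy.2 i
    have h2 : ∑ k, S.a i k * s k - ∑ k, S.a i k * y k = ∑ k, S.a i k * (s k - y k) := by
      rw [← Finset.sum_sub_distrib]
      exact Finset.sum_congr rfl fun k _ => by ring
    have h3 : ε j * (s j - y j) - ∑ k, (if S.a i k * ε k = -1 then z k else 0)
        ≤ ∑ k, S.a i k * (s k - y k) := by
      have : ε j * (s j - y j) = ∑ k, if k = j then ε k * (s k - y k) else 0 := by simp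
      rw [this, ← Finset.sum_sub_distrib]
      refine Finset.sum_le_sum fun k _ => ?_
      by_cases hk : k = j
      · subst hk
        have : S.a i k = ε k := by
          rcases hu i k with h | h | h <;> rcases hε.val k with h' | h' | h' <;>
            simp [h, h'] at hi ⊢
        rw [if_pos rfl, if_neg (by rw [hi]; norm_num), this, sub_zero]
      · by_cases ha : S.a i k = 0
        · simp [ha, hk]
        · have hb := hε.head i j k (Ne.symm hk) hi ha
          have hk0 : ε k ≠ 0 := fun h => by simp [h] at hb
          have h4 := ih k hk0
          rw [hj₀ k hk] at h4
          have : S.a i k = -ε k := by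
            rcases hu i k with h | h | h <;> rcases hε.val k with h' | h' | h' <;>
              simp [h, h'] at hb ⊢
          rw [if_neg hk, if_pos hb, this]
          linarith
    unfold cost slack
    omega

end Descent

end IntSys

/-! ### Convergence of value iteration, and labelings from sets of literals. -/

namespace IntSys

variable {κ ι : Type*} [Fintype ι] {S : IntSys κ ι}

/-- Value iteration from above is stationary after as many rounds as there are coordinates. -/
theorem iterate_stationary {ε s c : ι → ℤ} {F : (ι → ℤ) → ι → ℤ} (hs : S.Feas s)
    (hc : ∀ j, 0 ≤ c j)
    (h1 : ∀ z j, (∀ j, 0 ≤ z j) → F z j ≤ c j)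
    (h2 : ∀ z i j, (∀ j, 0 ≤ z j) → S.a i j * ε j = 1 → F z j ≤ S.cost ε s z i)
    (h3 : ∀ z j, (∀ j, 0 ≤ z j) →
      F z j = c j ∨ ∃ i, S.a i j * ε j = 1 ∧ F z j = S.cost ε s z i) :
    F (F^[Fintype.card ι] c) = F^[Fintype.card ι] c ∧ ∀ j, 0 ≤ F^[Fintype.card ι] c j := by
  classical
  have hcost : ∀ z i, (∀ j, 0 ≤ z j) → 0 ≤ S.cost ε s z i := fun z i hz =>
    add_nonneg (slack_nonneg hs i) (Finset.sum_nonneg fun k _ => by split_ifs; exacts [hz k, le_rfl])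
  have hF0 : ∀ z, (∀ j, 0 ≤ z j) → ∀ j, 0 ≤ F z j := fun z hz j => by
    rcases h3 z j hz with h | ⟨i, _, h⟩ <;> rw [h]
    exacts [hc j, hcost z i hz]
  have hmono : ∀ z z', (∀ j, 0 ≤ z j) → (∀ j, 0 ≤ z' j) → (∀ j, z j ≤ z' j) →
      ∀ j, F z j ≤ F z' j := fun z z' hz hz' hzz j => by
    rcases h3 z' j hz' with h | ⟨i, hi, h⟩ <;> rw [h]
    exacts [h1 z j hz, (h2 z i j hz hi).trans (cost_mono hzz i)]
  set Z : ℕ → ι → ℤ := fun r => F^[r] c with hZ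
  have hsucc : ∀ r, Z (r + 1) = F (Z r) := fun r => Function.iterate_succ_apply' F r c
  have hZ0 : ∀ r j, 0 ≤ Z r j := by
    intro r
    induction r with
    | zero => exact hc
    | succ r ih => rw [hsucc]; exact hF0 _ ih
  have hdec : ∀ r j, Z (r + 1) j ≤ Z r j := by
    intro r
    induction r with
    | zero => intro j; rw [hsucc]; exact h1 _ j (hZ0 0)
    | succ r ih => rw [hsucc (r + 1), hsucc r]; exact hmono _ _ (hsucc r ▸ hZ0 (r + 1)) (hZ0 r)
                     (hsucc r ▸ ih)
  -- the sequence becomes stationary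
  obtain ⟨R, hR⟩ : ∃ R, Z (R + 1) = Z R := by
    by_contra! h
    have hsum : ∀ r : ℕ, ∑ j, Z r j ≤ ∑ j, Z 0 j - r := by
      intro r
      induction r with
      | zero => simp
      | succ r ih =>
        obtain ⟨j, hj⟩ : ∃ j, Z (r + 1) j < Z r j := by
          by_contra! h'
          exact h r (funext fun j => le_antisymm (hdec r j) (h' j))
        have := Finset.sum_lt_sum (fun j _ => hdec r j) ⟨j, Finset.mem_univ j, hj⟩
        push_cast
        omega
    have h4 := hsum ((∑ j, Z 0 j).toNat + 1)
    have h5 : 0 ≤ ∑ j, Z ((∑ j, Z 0 j).toNat + 1) j := Finset.sum_nonneg fun j _ => hZ0 _ j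
    push_cast at h4
    have := Int.self_le_toNat (∑ j, Z 0 j)
    omega
  have hstat : ∀ k, Z (R + k) = Z R := by
    intro k
    induction k with
    | zero => rfl
    | succ k ih => rw [← add_assoc, hsucc, ih, ← hsucc, hR]
  have hanti : ∀ j, Antitone fun r => Z r j := fun j => antitone_nat_of_succ_le fun r => hdec r j
  have hge : ∀ r j, Z R j ≤ Z r j := fun r j => by
    rw [← hstat r]
    exact hanti j (by omega : r ≤ R + r)
  set G : ℕ → Finset ι := fun r => Finset.univ.filter fun j => Z r j = Z R j with hG
  have hGmono : Monotone G := monotone_nat_of_le_succ fun r j hj => by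
    simp only [hG, Finset.mem_filter, Finset.mem_univ, true_and] at hj ⊢
    exact le_antisymm ((hdec r j).trans hj.le) (hge _ j)
  -- A coordinate that becomes final through a row needs all body members of that row to be final
  -- one round earlier, since the cost is strictly increasing in each of them. If the final set did
  -- not grow in that round, the members were final already, and the coordinate becomes final one
  -- round sooner.
  have hstab : ∀ r, (G r).card = (G (r + 1)).card → (G (r + 1)).card = (G (r + 2)).card := by
    intro r hr
    have hGr : G r = G (r + 1) := Finset.eq_of_subset_of_card_le (hGmono (by omega)) hr.ge
    congr 1
    refine Finset.Subset.antisymm (hGmono (by omega)) fun j hj => ?_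
    simp only [hG, Finset.mem_filter, Finset.mem_univ, true_and] at hj ⊢
    refine le_antisymm ?_ (hge _ j)
    rcases h3 (Z (r + 1)) j (hZ0 _) with h | ⟨i, hi, h⟩
    · rw [← hj, hsucc (r + 1), h, hsucc]
      exact h1 _ j (hZ0 r)
    · have h4 : S.cost ε s (Z (r + 1)) i ≤ S.cost ε s (Z R) i := by
        rw [← h, ← hsucc, hj, ← congrFun hR j, hsucc]
        exact h2 _ i j (hZ0 R) hi
      have h5 : ∀ k, S.a i k * ε k = -1 → Z (r + 1) k = Z R k := by
        by_contra! hne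
        obtain ⟨k, hk, hne⟩ := hne
        refine absurd h4 (not_le.2 ?_)
        unfold cost
        refine add_lt_add_right (Finset.sum_lt_sum (fun l _ => ?_) ⟨k, Finset.mem_univ k, ?_⟩) _
        · split_ifs; exacts [hge _ l, le_rfl]
        · simpa [hk] using lt_of_le_of_ne (hge (r + 1) k) hne.symm
      have h6 : S.cost ε s (Z r) i = S.cost ε s (Z (r + 1)) i := by
        unfold cost
        congr 1
        refine Finset.sum_congr rfl fun k _ => ?_
        split_ifs with hk
        · have : k ∈ G (r + 1) := by simpa [hG] using h5 k hk
          rw [← hGr] at this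
          simp only [hG, Finset.mem_filter, Finset.mem_univ, true_and] at this
          rw [this, h5 k hk]
        · rfl
      calc Z (r + 1) j ≤ S.cost ε s (Z r) i := by rw [hsucc]; exact h2 _ i j (hZ0 r) hi
        _ = Z R j := by rw [h6, ← h, ← hsucc, hj]
  have hcard := Nat.stabilises_of_monotone (f := fun r => (G r).card)
    (fun _ _ h => Finset.card_le_card (hGmono h)) (fun r => Finset.card_le_univ _) hstab
    (le_max_left (Fintype.card ι) R)
  have hGu : G (Fintype.card ι) = Finset.univ := by
    have h4 : G (max (Fintype.card ι) R) = Finset.univ := by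
      obtain ⟨k, hk⟩ := Nat.exists_eq_add_of_le (le_max_right (Fintype.card ι) R)
      simp [hG, hk, hstat k]
    rw [h4, Finset.card_univ] at hcard
    exact Finset.card_eq_iff_eq_univ _ |>.1 hcard.symm
  have hfin : Z (Fintype.card ι) = Z R := funext fun j => by
    have : j ∈ G (Fintype.card ι) := hGu ▸ Finset.mem_univ j
    simpa [hG] using this
  refine ⟨?_, hZ0 _⟩
  change F (Z _) = Z _
  rw [hfin, ← hsucc, hR]

/-! ### Labelings from sets of literals -/

/-- Implications between literals `(j, e)` of weight at least `1/2`. -/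
def ClosedLits (S : IntSys κ ι) (X : Set (ι × ℤ)) : Prop :=
  ∀ i j k, j ≠ k → S.a i j ≠ 0 → S.a i k ≠ 0 → (k, S.a i k) ∈ X → (j, -S.a i j) ∈ X

open Classical in
/-- No row contains three literals of weight at least `1/2`. -/
def SparseLits (S : IntSys κ ι) (X : Set (ι × ℤ)) : Prop :=
  ∀ i, (Finset.univ.filter fun j => S.a i j ≠ 0 ∧ (j, S.a i j) ∈ X).card ≤ 2

/-- One of the two literals of a coordinate belongs to the set. -/
def Touched (X : Set (ι × ℤ)) (j : ι) : Prop := (j, 1) ∈ X ∨ (j, -1) ∈ X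

theorem SparseLits.mono {X Y : Set (ι × ℤ)} (h : S.SparseLits Y) (hXY : X ⊆ Y) :
    S.SparseLits X := fun i => (Finset.card_le_card fun j hj => by
  simp only [Finset.mem_filter, Finset.mem_univ, true_and] at hj ⊢
  exact ⟨hj.1, hXY hj.2⟩).trans (h i)

omit [Fintype ι] in
theorem Touched.of_mem (hu : S.IsUnit) {X : Set (ι × ℤ)} {i : κ} {j : ι} (h0 : S.a i j ≠ 0)
    (h : (j, S.a i j) ∈ X ∨ (j, -S.a i j) ∈ X) : Touched X j := by
  rcases hu i j with h' | h' | h'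
  · exact absurd h' h0
  · rw [h'] at h; exact h
  · rw [h', neg_neg] at h; exact h.symm

/-- A solution extends every closed sparse set. -/
theorem exists_extension (hu : S.IsUnit) {X Y : Set (ι × ℤ)} (hX : S.ClosedLits X)
    (hX' : S.SparseLits X) (hY : S.ClosedLits Y) (hY' : S.SparseLits Y) (ht : ∀ j, Touched Y j) :
    ∃ W : Set (ι × ℤ), X ⊆ W ∧ S.ClosedLits W ∧ S.SparseLits W ∧ ∀ j, Touched W j := by
  classical
  refine ⟨X ∪ {p | p ∈ Y ∧ ¬ Touched X p.1}, Set.subset_union_left, ?_, fun i => ?_, fun j => ?_⟩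
  · rintro i j k hjk hj hk (h | ⟨h, hkX⟩)
    · exact .inl (hX i j k hjk hj hk h)
    -- If `j` is touched and the required literal were absent, the opposite literal of `j` would lie
    -- in `X`, and closedness would make `X` touch `k`.
    · by_cases hjX : Touched X j
      · left
        by_contra hne
        have : (j, S.a i j) ∈ X := by
          rcases hu i j with h' | h' | h'
          · exact absurd h' hj
          · rw [h'] at hne ⊢; exact hjX.resolve_right hne
          · rw [h', neg_neg] at hne; rw [h']; exact hjX.resolve_left hne
        exact hkX (.of_mem hu hk (.inr (hX i k j hjk.symm hk hj this)))
      · exact .inr ⟨hY i j k hjk hj hk h, hjX⟩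
  -- One literal of the row in `X` forces `X` to touch every coordinate of the row, so `X` and `Y`
  -- never share the count of a row.
  · by_cases h : ∃ k, S.a i k ≠ 0 ∧ (k, S.a i k) ∈ X
    · obtain ⟨k, hk, hkX⟩ := h
      refine le_trans (Finset.card_le_card fun j hj => ?_) (hX' i)
      simp only [Finset.mem_filter, Finset.mem_univ, true_and] at hj ⊢
      refine ⟨hj.1, hj.2.resolve_right fun h => h.2 ?_⟩
      by_cases hjk : j = k
      · subst hjk; exact .of_mem hu hk (.inl hkX)
      · exact .of_mem hu hj.1 (.inr (hX i j k hjk hj.1 hk hkX))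
    · push Not at h
      refine le_trans (Finset.card_le_card fun j hj => ?_) (hY' i)
      simp only [Finset.mem_filter, Finset.mem_univ, true_and] at hj ⊢
      exact ⟨hj.1, (hj.2.resolve_left (h j hj.1)).1⟩
  · by_cases h : Touched X j
    · exact h.imp .inl .inl
    · exact (ht j).imp (fun h' => .inr ⟨h', h⟩) (fun h' => .inr ⟨h', h⟩)

open Classical in
/-- The labeling that belongs to a set of literals. -/
noncomputable def labelOf (X : Set (ι × ℤ)) (j : ι) : ℤ :=
  (if (j, 1) ∈ X then 1 else 0) - (if (j, -1) ∈ X then 1 else 0)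

/-- A literal has weight 1 when its negation is missing from `X`. The contrapositive of closedness
then removes the other literals of the row, and touchedness supplies their negations. -/
theorem isLabeling_labelOf (hu : S.IsUnit) {X : Set (ι × ℤ)} (hX : S.ClosedLits X)
    (hX' : S.SparseLits X) (ht : ∀ j, Touched X j) : S.IsLabeling (labelOf X) := by
  classical
  refine ⟨fun j => ?_, fun i j k hjk h hk => ?_, fun i => ?_⟩
  · unfold labelOf; split_ifs <;> simp
  · have hj : S.a i j ≠ 0 := fun h' => by simp [h'] at h
    have hjX : (j, -S.a i j) ∉ X := by
      intro hmem
      rcases hu i j with h' | h' | h'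
      · exact hj h'
      · rw [h'] at h hmem; simp [labelOf, hmem] at h
        split_ifs at h <;> omega
      · rw [h', neg_neg] at hmem; rw [h'] at h; simp [labelOf, hmem] at h
        split_ifs at h <;> omega
    have hkX : (k, S.a i k) ∉ X := fun h' => hjX (hX i j k hjk hj hk h')
    have htk := ht k
    rcases hu i k with h' | h' | h'
    · exact absurd h' hk
    all_goals
      rw [h'] at hkX ⊢
      unfold Touched at htk
      simp only [hkX, or_false, false_or] at htk
      simp [labelOf, hkX, htk]
  · refine le_trans (Finset.card_le_card fun j hj => ?_) (hX' i)
    simp only [Finset.mem_filter, Finset.mem_univ, true_and] at hj ⊢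
    obtain ⟨hj, h0⟩ := hj
    refine ⟨hj, ?_⟩
    have htj := ht j
    unfold Touched at htj
    unfold labelOf at h0
    rcases hu i j with h' | h' | h'
    · exact absurd h' hj
    all_goals
      rw [h']
      split_ifs at h0 <;> simp_all

end IntSys

/-! ### Closures in finite lists -/

/-- Enlarge a sublist of `U` by the members that satisfy `F` until it is stationary. -/
def listClosure {τ : Type*} (U : List τ) (F : List τ → τ → Bool) (X : List τ) : List τ :=
  U.foldl (fun X _ => U.filter (F X)) (U.filter (F X))

theorem listClosure_eq {τ : Type*} (U : List τ) (F : List τ → τ → Bool) (X : List τ) :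
    listClosure U F X = (fun X => U.filter (F X))^[U.length + 1] X := by
  rw [Function.iterate_succ_apply, listClosure, List.foldl_const]

theorem listClosure_sublist {τ : Type*} (U : List τ) (F : List τ → τ → Bool) (X : List τ) :
    (listClosure U F X).Sublist U := by
  rw [listClosure_eq, Function.iterate_succ_apply']
  exact List.filter_sublist

theorem listClosure_invariant {τ : Type*} {U : List τ} {F : List τ → τ → Bool} {X : List τ}
    (R : List τ → Prop) (h0 : R X) (h : ∀ X, R X → R (U.filter (F X))) :
    R (listClosure U F X) := by
  rw [listClosure_eq]
  generalize U.length + 1 = N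
  induction N with
  | zero => exact h0
  | succ N ih => rw [Function.iterate_succ_apply']; exact h _ ih

theorem listClosure_induction {τ : Type*} {U : List τ} {F : List τ → τ → Bool} {X : List τ}
    (Q : τ → Prop) (h0 : ∀ p ∈ X, Q p) (h : ∀ X, (∀ p ∈ X, Q p) → ∀ p ∈ U, F X p = true → Q p) :
    ∀ p ∈ listClosure U F X, Q p :=
  listClosure_invariant (fun X => ∀ p ∈ X, Q p) h0 fun X hX p hp =>
    h X hX p (List.mem_filter.1 hp).1 (List.mem_filter.1 hp).2

/-- The closure is stationary if `F` is inflationary. -/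
theorem filter_listClosure {τ : Type*} {U : List τ} {F : List τ → τ → Bool} {X : List τ}
    (hinf : ∀ X, ∀ p ∈ X, F X p = true) :
    U.filter (F (listClosure U F X)) = listClosure U F X := by
  set Z : ℕ → List τ := fun r => (fun X => U.filter (F X))^[r] X with hZ
  have hsucc : ∀ r, Z (r + 1) = U.filter (F (Z r)) := fun r =>
    Function.iterate_succ_apply' _ r X
  -- The start `X` need not be a sublist of `U`, so monotonicity of the lists begins after the first
  -- round; this accounts for the extra round.
  have hsub : ∀ r, (Z (r + 1)).Sublist (Z (r + 2)) := by
    intro r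
    have : U.filter (F (Z r)) = (U.filter (F (Z (r + 1)))).filter (F (Z r)) := by
      rw [List.filter_filter]
      refine List.filter_congr fun p hp => ?_
      cases h : F (Z r) p
      · rfl
      · simp [hinf (Z (r + 1)) p (by rw [hsucc]; exact List.mem_filter.2 ⟨hp, h⟩)]
    have h := List.filter_sublist (p := F (Z r)) (l := U.filter (F (Z (r + 1))))
    rwa [← this, ← hsucc, ← hsucc] at h
  have hlen : ∀ r, (Z (r + 1)).length ≤ U.length := fun r => by
    rw [hsucc]; exact List.length_filter_le _ _
  have := Nat.stabilises_of_monotone (f := fun r => (Z (r + 1)).length) (n := U.length + 1)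
    (monotone_nat_of_le_succ fun r => (hsub r).length_le) hlen (fun r hr => by
      have : Z (r + 1) = Z (r + 2) := (hsub r).eq_of_length hr
      rw [hsucc (r + 1), this, ← hsucc]) (by omega)
  have h2 : Z (U.length + 1) = Z (U.length + 2) := (hsub _).eq_of_length this.symm
  rw [listClosure_eq]
  exact (hsucc _).symm.trans h2.symm

/-! ## The algorithm -/

namespace ReconfAlg

open WhileLang

/-- The matrix entry in row `i` and column `j`; entries are given as numerator and denominator. -/
def ent (A : List (List (ℤ × ℤ))) (i j : ℕ) : ℤ := ((A.getD i []).getD j (0, 0)).1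

/-- The right-hand side of row `i`, rounded up. -/
def bnd (b : List (ℤ × ℤ)) (i : ℕ) : ℤ := -(-(b.getD i (0, 1)).1 / (b.getD i (0, 1)).2)

def memLit (X : List (ℕ × ℤ)) (j : ℕ) (e : ℤ) : Bool :=
  X.any fun q => decide (q.1 = j) && decide (q.2 = e)

def memIdx (X : List ℕ) (j : ℕ) : Bool := X.any fun q => decide (q = j)

/-! ### Computing a labeling -/

def litStep (A : List (List (ℤ × ℤ))) (J : List ℕ) (X : List (ℕ × ℤ)) (p : ℕ × ℤ) : Bool :=
  memLit X p.1 p.2 || (List.range A.length).any fun i =>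
    (decide (ent A i p.1 = -p.2) && !decide (ent A i p.1 = 0)) && J.any fun k =>
      (!decide (k = p.1) && !decide (ent A i k = 0)) && memLit X k (ent A i k)

def sparse (A : List (List (ℤ × ℤ))) (J : List ℕ) (X : List (ℕ × ℤ)) : Bool :=
  (List.range A.length).all fun i => decide ((J.map fun k =>
    bif !decide (ent A i k = 0) && memLit X k (ent A i k) then (1 : ℤ) else 0).sum ≤ 2)

def lits (J : List ℕ) : List (ℕ × ℤ) :=
  J.map (fun j => (j, (1 : ℤ))) ++ J.map (fun j => (j, (-1 : ℤ)))

def litClosure (A : List (List (ℤ × ℤ))) (J : List ℕ) (X : List (ℕ × ℤ)) : List (ℕ × ℤ) :=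
  listClosure (lits J) (litStep A J) X

/-- A touched coordinate is never revised; `exists_extension` is what makes backtracking
unnecessary. -/
def greedyStep (A : List (List (ℤ × ℤ))) (J : List ℕ) (X : List (ℕ × ℤ)) (j : ℕ) : List (ℕ × ℤ) :=
  bif memLit X j 1 || memLit X j (-1) then X else
    bif sparse A J (litClosure A J ((j, 1) :: X)) then litClosure A J ((j, 1) :: X)
    else litClosure A J ((j, -1) :: X)

def greedy (A : List (List (ℤ × ℤ))) (J : List ℕ) : List (ℕ × ℤ) := J.foldl (greedyStep A J) []

def labels (A : List (List (ℤ × ℤ))) (J : List ℕ) : List ℤ := J.map fun j =>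
  (bif memLit (greedy A J) j 1 then 1 else 0) - (bif memLit (greedy A J) j (-1) then 1 else 0)

/-! ### Descending to the least element of a component -/

section

variable (A : List (List (ℤ × ℤ))) (b : List (ℤ × ℤ)) (d : ℤ) (J : List ℕ) (ε s : List ℤ)

def slackL (i : ℕ) : ℤ := (J.map fun k => ent A i k * s.getD k 0).sum - bnd b i

def capL (j : ℕ) : ℤ :=
  bif decide (ε.getD j 0 = 1) then s.getD j 0 else
    bif decide (ε.getD j 0 = -1) then d - s.getD j 0 else 0

def costL (z : List ℤ) (i : ℕ) : ℤ :=
  slackL A b J s i + (J.map fun k =>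
    bif decide (ent A i k * ε.getD k 0 = -1) then z.getD k 0 else 0).sum

def activeStep (X : List ℕ) (j : ℕ) : Bool :=
  memIdx X j || (decide (0 < capL d ε s j) && (List.range A.length).all fun i =>
    !decide (ent A i j * ε.getD j 0 = 1) || (decide (0 < slackL A b J s i) ||
      J.any fun k => decide (ent A i k * ε.getD k 0 = -1) && memIdx X k))

def active : List ℕ := listClosure J (activeStep A b d J ε s) []

def startValues : List ℤ := J.map fun j =>
  bif memIdx (active A b d J ε s) j then capL d ε s j else 0

/-- The minimum with `c` and the truncation at `0` keep all entries between `0` and `max 0 (c j)`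
for arbitrary `z`, which bounds their bit length. On nonnegative data from a feasible point the
truncation has no effect. -/
def valueStep (c z : List ℤ) : List ℤ := J.map fun j =>
  max 0 ((((List.range A.length).filter fun i => decide (ent A i j * ε.getD j 0 = 1)).map
    (costL A b J ε s z)).foldl min (c.getD j 0))

def values : List ℤ :=
  J.foldl (fun z _ => valueStep A b J ε s (startValues A b d J ε s) z) (startValues A b d J ε s)

def descend : List ℤ := J.map fun j =>
  s.getD j 0 - ε.getD j 0 * (values A b d J ε s).getD j 0

end

/-! ### Moving towards the target -/

def sgn (x y : ℤ) : ℤ := bif decide (x < y) then 1 else bif decide (y < x) then -1 else 0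

def movedL (s t : List ℤ) (X : List ℕ) (k : ℕ) : ℤ :=
  s.getD k 0 + bif memIdx X k then sgn (s.getD k 0) (t.getD k 0) else 0

def moveStep (A : List (List (ℤ × ℤ))) (b : List (ℤ × ℤ)) (J : List ℕ) (s t : List ℤ)
    (X : List ℕ) (j : ℕ) : Bool :=
  memIdx X j || (!decide (s.getD j 0 = t.getD j 0) && (List.range A.length).all fun i =>
    decide (bnd b i ≤ (J.map fun k => ent A i k * movedL s t (j :: X) k).sum))

def moves (A : List (List (ℤ × ℤ))) (b : List (ℤ × ℤ)) (J : List ℕ) (s t : List ℤ) : List ℕ :=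
  listClosure J (moveStep A b J s t) []

def joinedL (A : List (List (ℤ × ℤ))) (b : List (ℤ × ℤ)) (J : List ℕ) (ε s t : List ℤ) : Bool :=
  (J.all fun j => decide (ε.getD j 0 = 0) || decide (s.getD j 0 = t.getD j 0)) &&
    J.all fun j => decide (s.getD j 0 = t.getD j 0) || memIdx (moves A b J s t) j

/-- Both endpoints are first replaced by the least points of their components; only these are
compared. -/
def solve (x : ℕ × ℕ × List (List (ℤ × ℤ)) × List (ℤ × ℤ) × ℤ × List ℤ × List ℤ) : Bool :=
  joinedL x.2.2.1 x.2.2.2.1 (List.range x.2.2.2.2.2.1.length)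
    (labels x.2.2.1 (List.range x.2.2.2.2.2.1.length))
    (descend x.2.2.1 x.2.2.2.1 x.2.2.2.2.1 (List.range x.2.2.2.2.2.1.length)
      (labels x.2.2.1 (List.range x.2.2.2.2.2.1.length)) x.2.2.2.2.2.1)
    (descend x.2.2.1 x.2.2.2.1 x.2.2.2.2.1 (List.range x.2.2.2.2.2.1.length)
      (labels x.2.2.1 (List.range x.2.2.2.2.2.1.length)) x.2.2.2.2.2.2)

/-! ### Polynomial cost -/

section Cost

variable {α τ : Type*} [Enc α] [Enc τ]

/-- After each round the accumulator is a sublist of `U`, so its size does not depend on the number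
of rounds. -/
theorem polyComp_listClosure {U X : α → List τ} {F : α → List τ → τ → Bool}
    (hF : PolyComp (fun p : α × List τ × τ => F p.1 p.2.1 p.2.2)) (hU : PolyComp U)
    (hX : PolyComp X) : PolyComp (fun a => listClosure (U a) (F a) (X a)) := by
  unfold listClosure
  refine .foldl (f := fun a X _ => (U a).filter (F a X)) ?_ hU ?_ ?_
  · exact .filter (f := fun (p : α × List τ × τ) c => F p.1 p.2.1 c)
      (hF.comp (by fun_prop : PolyComp fun p : (α × List τ × τ) × τ => (p.1.1, p.1.2.1, p.2)))
      (by fun_prop)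
  · exact .filter (f := fun a c => F a (X a) c)
      (hF.comp (by fun_prop : PolyComp fun p : α × τ => (p.1, X p.1, p.2))) (by fun_prop)
  · obtain ⟨q, hq⟩ := hU.polyBdd
    exact ⟨q, fun a c hc X => (esize_le_of_sublist List.filter_sublist).trans
      ((hq a).trans (Nat.le_add_left _ _))⟩

attribute [local fun_prop] PolyComp.map PolyComp.filter PolyComp.all PolyComp.any
  polyComp_listClosure

variable {A : α → List (List (ℤ × ℤ))} {b : α → List (ℤ × ℤ)} {i j : α → ℕ} {d : α → ℤ}
  {J : α → List ℕ} {ε s t z : α → List ℤ}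

@[fun_prop]
theorem polyComp_ent (hA : PolyComp A) (hi : PolyComp i) (hj : PolyComp j) :
    PolyComp fun a => ent (A a) (i a) (j a) := by
  unfold ent; fun_prop

@[fun_prop]
theorem polyComp_bnd (hb : PolyComp b) (hi : PolyComp i) : PolyComp fun a => bnd (b a) (i a) := by
  unfold bnd; fun_prop

@[fun_prop]
theorem polyComp_memLit {X : α → List (ℕ × ℤ)} {e : α → ℤ} (hX : PolyComp X) (hj : PolyComp j)
    (he : PolyComp e) : PolyComp fun a => memLit (X a) (j a) (e a) := by
  unfold memLit; fun_prop

@[fun_prop]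
theorem polyComp_memIdx {X : α → List ℕ} (hX : PolyComp X) (hj : PolyComp j) :
    PolyComp fun a => memIdx (X a) (j a) := by
  unfold memIdx; fun_prop

@[fun_prop]
theorem polyComp_litStep {X : α → List (ℕ × ℤ)} {p : α → ℕ × ℤ} (hA : PolyComp A)
    (hJ : PolyComp J) (hX : PolyComp X) (hp : PolyComp p) :
    PolyComp fun a => litStep (A a) (J a) (X a) (p a) := by
  unfold litStep; fun_prop

@[fun_prop]
theorem polyComp_sparse {X : α → List (ℕ × ℤ)} (hA : PolyComp A)
    (hJ : PolyComp J) (hX : PolyComp X) : PolyComp fun a => sparse (A a) (J a) (X a) := by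
  unfold sparse; fun_prop

@[fun_prop]
theorem polyComp_lits (hJ : PolyComp J) : PolyComp fun a => lits (J a) := by
  unfold lits; fun_prop

@[fun_prop]
theorem polyComp_litClosure {X : α → List (ℕ × ℤ)} (hA : PolyComp A)
    (hJ : PolyComp J) (hX : PolyComp X) : PolyComp fun a => litClosure (A a) (J a) (X a) := by
  unfold litClosure; fun_prop

@[fun_prop]
theorem polyComp_greedyStep {X : α → List (ℕ × ℤ)} (hA : PolyComp A) (hJ : PolyComp J)
    (hX : PolyComp X) (hj : PolyComp j) :
    PolyComp fun a => greedyStep (A a) (J a) (X a) (j a) := by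
  unfold greedyStep; fun_prop

@[fun_prop]
theorem polyComp_greedy (hA : PolyComp A) (hJ : PolyComp J) :
    PolyComp fun a => greedy (A a) (J a) := by
  unfold greedy
  refine .foldl (f := fun a X j => greedyStep (A a) (J a) X j) (by fun_prop) hJ (by fun_prop) ?_
  obtain ⟨q, hq⟩ := (polyComp_lits hJ).polyBdd
  refine ⟨q, fun a c _ X => ?_⟩
  have h : ∀ X, esize (litClosure (A a) (J a) X) ≤ q.eval (esize a) := fun X =>
    (esize_le_of_sublist (listClosure_sublist _ _ _)).trans (hq a)
  have h1 := h ((c, 1) :: X)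
  have h2 := h ((c, -1) :: X)
  unfold greedyStep
  cases memLit X c 1 || memLit X c (-1) <;>
    cases sparse (A a) (J a) (litClosure (A a) (J a) ((c, 1) :: X)) <;>
    simp only [cond_true, cond_false] <;> omega

@[fun_prop]
theorem polyComp_labels (hA : PolyComp A) (hJ : PolyComp J) :
    PolyComp fun a => labels (A a) (J a) := by
  unfold labels; fun_prop

@[fun_prop]
theorem polyComp_slackL (hA : PolyComp A) (hb : PolyComp b) (hJ : PolyComp J) (hs : PolyComp s)
    (hi : PolyComp i) : PolyComp fun a => slackL (A a) (b a) (J a) (s a) (i a) := by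
  unfold slackL; fun_prop

@[fun_prop]
theorem polyComp_capL (hd : PolyComp d) (hε : PolyComp ε) (hs : PolyComp s)
    (hj : PolyComp j) : PolyComp fun a => capL (d a) (ε a) (s a) (j a) := by
  unfold capL; fun_prop

@[fun_prop]
theorem polyComp_costL (hA : PolyComp A) (hb : PolyComp b) (hJ : PolyComp J) (hε : PolyComp ε)
    (hs : PolyComp s) (hz : PolyComp z) (hi : PolyComp i) :
    PolyComp fun a => costL (A a) (b a) (J a) (ε a) (s a) (z a) (i a) := by
  unfold costL; fun_prop

@[fun_prop]
theorem polyComp_activeStep {X : α → List ℕ} (hA : PolyComp A) (hb : PolyComp b) (hd : PolyComp d)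
    (hJ : PolyComp J) (hε : PolyComp ε) (hs : PolyComp s) (hX : PolyComp X) (hj : PolyComp j) :
    PolyComp fun a => activeStep (A a) (b a) (d a) (J a) (ε a) (s a) (X a) (j a) := by
  unfold activeStep; fun_prop

@[fun_prop]
theorem polyComp_active (hA : PolyComp A) (hb : PolyComp b) (hd : PolyComp d)
    (hJ : PolyComp J) (hε : PolyComp ε) (hs : PolyComp s) :
    PolyComp fun a => active (A a) (b a) (d a) (J a) (ε a) (s a) := by
  unfold active; fun_prop

@[fun_prop]
theorem polyComp_startValues (hA : PolyComp A) (hb : PolyComp b) (hd : PolyComp d)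
    (hJ : PolyComp J) (hε : PolyComp ε) (hs : PolyComp s) :
    PolyComp fun a => startValues (A a) (b a) (d a) (J a) (ε a) (s a) := by
  unfold startValues; fun_prop

@[fun_prop]
theorem polyComp_valueStep {c : α → List ℤ} (hA : PolyComp A) (hb : PolyComp b)
    (hJ : PolyComp J) (hε : PolyComp ε) (hs : PolyComp s) (hc : PolyComp c) (hz : PolyComp z) :
    PolyComp fun a => valueStep (A a) (b a) (J a) (ε a) (s a) (c a) (z a) := by
  unfold valueStep; fun_prop

theorem foldl_min_le (l : List ℤ) (c : ℤ) : l.foldl min c ≤ c := by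
  induction l generalizing c with
  | nil => exact le_rfl
  | cons x l ih => exact (ih _).trans (min_le_left _ _)

-- Costs are sums and could grow from round to round, but each entry is cut off by its start value.
@[fun_prop]
theorem polyComp_values (hA : PolyComp A) (hb : PolyComp b) (hd : PolyComp d)
    (hJ : PolyComp J) (hε : PolyComp ε) (hs : PolyComp s) :
    PolyComp fun a => values (A a) (b a) (d a) (J a) (ε a) (s a) := by
  unfold values
  have hc := polyComp_startValues hA hb hd hJ hε hs
  set c := fun a => startValues (A a) (b a) (d a) (J a) (ε a) (s a)
  refine .foldl (f := fun a z _ => valueStep (A a) (b a) (J a) (ε a) (s a) (c a) z)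
    (by fun_prop) hJ hc ?_
  obtain ⟨q, hq⟩ := PolyComp.bdd_of_mem (f := fun a j => (c a).getD j 0) (l := J) (by fun_prop) hJ
  obtain ⟨r, hr⟩ := hJ.polyBdd
  refine ⟨r * (q + 1) + 1, fun a _ _ z => ?_⟩
  refine le_trans (esize_le_of_forall (B := q.eval (esize a)) fun x hx => ?_) ?_
  · obtain ⟨j, hj, rfl⟩ := List.mem_map.1 hx
    refine le_trans (esize_le_of_natAbs_le ?_) (hq a j hj)
    have := foldl_min_le ((((List.range (A a).length).filter
      fun i => decide (ent (A a) i j * (ε a).getD j 0 = 1)).map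
      (costL (A a) (b a) (J a) (ε a) (s a) z))) ((c a).getD j 0)
    omega
  · have h1 := (length_le_esize (J a)).trans (hr a)
    have h2 := Nat.mul_le_mul_right (q.eval (esize a) + 1) h1
    simp only [valueStep, List.length_map, Polynomial.eval_add, Polynomial.eval_mul,
      Polynomial.eval_one]
    omega

@[fun_prop]
theorem polyComp_descend (hA : PolyComp A) (hb : PolyComp b) (hd : PolyComp d)
    (hJ : PolyComp J) (hε : PolyComp ε) (hs : PolyComp s) :
    PolyComp fun a => descend (A a) (b a) (d a) (J a) (ε a) (s a) := by
  unfold descend; fun_prop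

@[fun_prop]
theorem polyComp_sgn {x y : α → ℤ} (hx : PolyComp x) (hy : PolyComp y) :
    PolyComp fun a => sgn (x a) (y a) := by
  unfold sgn; fun_prop

@[fun_prop]
theorem polyComp_movedL {X : α → List ℕ} (hs : PolyComp s) (ht : PolyComp t) (hX : PolyComp X)
    (hj : PolyComp j) : PolyComp fun a => movedL (s a) (t a) (X a) (j a) := by
  unfold movedL; fun_prop

@[fun_prop]
theorem polyComp_moveStep {X : α → List ℕ} (hA : PolyComp A) (hb : PolyComp b) (hJ : PolyComp J)
    (hs : PolyComp s) (ht : PolyComp t) (hX : PolyComp X) (hj : PolyComp j) :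
    PolyComp fun a => moveStep (A a) (b a) (J a) (s a) (t a) (X a) (j a) := by
  unfold moveStep; fun_prop

@[fun_prop]
theorem polyComp_moves (hA : PolyComp A) (hb : PolyComp b) (hJ : PolyComp J)
    (hs : PolyComp s) (ht : PolyComp t) :
    PolyComp fun a => moves (A a) (b a) (J a) (s a) (t a) := by
  unfold moves; fun_prop

@[fun_prop]
theorem polyComp_joinedL (hA : PolyComp A) (hb : PolyComp b) (hJ : PolyComp J) (hε : PolyComp ε)
    (hs : PolyComp s) (ht : PolyComp t) :
    PolyComp fun a => joinedL (A a) (b a) (J a) (ε a) (s a) (t a) := by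
  unfold joinedL; fun_prop

theorem polyComp_solve : PolyComp solve := by
  unfold solve; fun_prop

end Cost
end ReconfAlg

/-! ## Correctness of the algorithm -/

namespace ReconfAlg

open IntSys

theorem map_range_eq_ofFn {β : Type*} (n : ℕ) (f : ℕ → β) :
    (List.range n).map f = List.ofFn fun j : Fin n => f j := by
  apply List.ext_getElem <;> simp

theorem sum_map_range (n : ℕ) (f : ℕ → ℤ) : ((List.range n).map f).sum = ∑ j : Fin n, f j := by
  rw [map_range_eq_ofFn, List.sum_ofFn]

theorem all_range (n : ℕ) (f : ℕ → Bool) :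
    (List.range n).all f = true ↔ ∀ j : Fin n, f j = true := by
  simp [List.all_eq_true, Fin.forall_iff]

theorem any_range (n : ℕ) (f : ℕ → Bool) :
    (List.range n).any f = true ↔ ∃ j : Fin n, f j = true := by
  simp [List.any_eq_true, Fin.exists_iff]

theorem getD_map_range {n : ℕ} (f : ℕ → ℤ) (j : Fin n) :
    ((List.range n).map f).getD j 0 = f j := by
  simp [List.getD_eq_getElem?_getD]

theorem memLit_iff {X : List (ℕ × ℤ)} {j : ℕ} {e : ℤ} : memLit X j e = true ↔ (j, e) ∈ X := by
  simp [memLit, ← Prod.mk_inj]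

theorem memIdx_iff {X : List ℕ} {j : ℕ} : memIdx X j = true ↔ j ∈ X := by
  simp [memIdx]

theorem mem_lits {n j : ℕ} {e : ℤ} : (j, e) ∈ lits (List.range n) ↔ j < n ∧ (e = 1 ∨ e = -1) := by
  simp only [lits, List.mem_append, List.mem_map, List.mem_range, Prod.mk.injEq]
  constructor
  · rintro (⟨k, hk, rfl, rfl⟩ | ⟨k, hk, rfl, rfl⟩) <;> simp [hk]
  · rintro ⟨hj, rfl | rfl⟩
    exacts [.inl ⟨j, hj, rfl, rfl⟩, .inr ⟨j, hj, rfl, rfl⟩]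

/-- The set of literals that is represented by a list. -/
def litSet (n : ℕ) (X : List (ℕ × ℤ)) : Set (Fin n × ℤ) := {p | ((p.1 : ℕ), p.2) ∈ X}

theorem mem_litSet {n : ℕ} {X : List (ℕ × ℤ)} {j : Fin n} {e : ℤ} :
    (j, e) ∈ litSet n X ↔ ((j : ℕ), e) ∈ X := Iff.rfl

/-! ### Correctness of the labeling. -/

section

variable {m n : ℕ} {S : IntSys (Fin m) (Fin n)} {A : List (List (ℤ × ℤ))} {b : List (ℤ × ℤ)}
  (hA : A.length = m) (hent : ∀ (i : Fin m) (j : Fin n), ent A i j = S.a i j)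
  (hb : ∀ i : Fin m, bnd b i = S.b i)

include hA hent

theorem litStep_iff {X : List (ℕ × ℤ)} {j : Fin n} {e : ℤ} :
    litStep A (List.range n) X (j, e) = true ↔ ((j : ℕ), e) ∈ X ∨ ∃ i, (S.a i j = -e ∧ S.a i j ≠ 0) ∧
      ∃ k : Fin n, (k ≠ j ∧ S.a i k ≠ 0) ∧ ((k : ℕ), S.a i k) ∈ X := by
  subst hA
  simp only [litStep, Bool.or_eq_true, Bool.and_eq_true, Bool.not_eq_true', any_range,
    memLit_iff, decide_eq_true_eq, decide_eq_false_iff_not, hent, Fin.val_inj, ne_eq]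

theorem sparse_iff {X : List (ℕ × ℤ)} :
    sparse A (List.range n) X = true ↔ S.SparseLits (litSet n X) := by
  classical
  subst hA
  simp only [sparse, all_range, decide_eq_true_eq, sum_map_range, SparseLits]
  refine forall_congr' fun i => ?_
  rw [Finset.card_filter, ← Nat.cast_le (α := ℤ), Nat.cast_sum]
  simp only [hent, mem_litSet, ← memLit_iff]
  refine Iff.of_eq (congrArg₂ _ (Finset.sum_congr rfl fun k _ => ?_) (by norm_num))
  by_cases h : S.a i k = 0
  · simp [h]
  · cases h' : memLit X k (S.a i k) <;> simp [h]

theorem closed_litClosure (hu : S.IsUnit) (X : List (ℕ × ℤ)) :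
    S.ClosedLits (litSet n (litClosure A (List.range n) X)) := by
  intro i j k hjk hj hk hmem
  rw [mem_litSet] at hmem ⊢
  have hfix := filter_listClosure (U := lits (List.range n)) (F := litStep A (List.range n)) (X := X)
    fun X p hp => by
      unfold litStep
      rw [memLit_iff.2 hp, Bool.true_or]
  change (lits (List.range n)).filter _ = litClosure A (List.range n) X at hfix
  rw [← hfix, List.mem_filter, mem_lits]
  refine ⟨⟨j.2, ?_⟩, ?_⟩
  · rcases hu i j with h | h | h
    · exact absurd h hj
    · simp [h]
    · simp [h]
  · exact (litStep_iff hA hent).2 (.inr ⟨i, ⟨(neg_neg _).symm, hj⟩, k, ⟨hjk.symm, hk⟩, hmem⟩)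

omit hA hent in
theorem subset_litClosure {X : List (ℕ × ℤ)} (hX : ∀ p ∈ X, p ∈ lits (List.range n)) :
    ∀ p ∈ X, p ∈ litClosure A (List.range n) X :=
  (listClosure_invariant (F := litStep A (List.range n)) (X := X)
    (fun Y => ∀ p ∈ X, p ∈ Y) (fun _ h => h) fun Y hY p hp => by
    refine List.mem_filter.2 ⟨hX p hp, ?_⟩
    unfold litStep
    rw [memLit_iff.2 (hY p hp), Bool.true_or])

/-- Each literal that is added is forced in every closed set containing `X`. -/
theorem litClosure_subset {X : List (ℕ × ℤ)} {Y : Set (Fin n × ℤ)} (hY : S.ClosedLits Y)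
    (hXY : litSet n X ⊆ Y) : litSet n (litClosure A (List.range n) X) ⊆ Y := by
  have := listClosure_induction (U := lits (List.range n)) (F := litStep A (List.range n)) (X := X)
    (fun p => ∀ h : p.1 < n, ((⟨p.1, h⟩ : Fin n), p.2) ∈ Y) (fun p hp h => hXY hp)
    fun Z hZ p _ hp h => by
      rcases (litStep_iff hA hent (j := ⟨p.1, h⟩) (e := p.2)).1 hp with h' | ⟨i, ⟨h1, h2⟩, k, ⟨h3, h4⟩, h5⟩
      · exact hZ _ h' h
      · have := hY i _ k h3.symm h2 h4 (hZ _ h5 k.2)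
        rwa [h1, neg_neg] at this
  rintro ⟨j, e⟩ hj
  exact this _ hj j.2

theorem greedy_spec (hu : S.IsUnit) (hsol : ∃ Y : Set (Fin n × ℤ), S.ClosedLits Y ∧
    S.SparseLits Y ∧ ∀ j, Touched Y j) :
    S.ClosedLits (litSet n (greedy A (List.range n))) ∧
    S.SparseLits (litSet n (greedy A (List.range n))) ∧
    ∀ j, Touched (litSet n (greedy A (List.range n))) j := by
  obtain ⟨Y, hY, hY', hYt⟩ := hsol
  suffices H : ∀ r ≤ n, ∀ X, X = (List.range r).foldl (greedyStep A (List.range n)) [] →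
      S.ClosedLits (litSet n X) ∧ S.SparseLits (litSet n X) ∧
      (∀ p ∈ X, p ∈ lits (List.range n)) ∧ ∀ j : Fin n, (j : ℕ) < r → Touched (litSet n X) j by
    obtain ⟨h1, h2, -, h3⟩ := H n le_rfl _ rfl
    exact ⟨h1, h2, fun j => h3 j j.2⟩
  intro r
  induction r with
  | zero =>
    rintro - X rfl
    refine ⟨?_, ?_, by simp, by simp⟩
    · intro i j k _ _ _ h; simp [litSet] at h
    · intro i; simp [litSet]
  | succ r ih =>
    rintro hr X' rfl
    obtain ⟨hX1, hX2, hX3, hX4⟩ := ih (by omega) _ rfl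
    rw [List.range_succ, List.foldl_append, List.foldl_cons, List.foldl_nil]
    generalize (List.range r).foldl (greedyStep A (List.range n)) [] = X at *
    have hpsub : ∀ e : ℤ, (e = 1 ∨ e = -1) → ∀ p ∈ (r, e) :: X, p ∈ lits (List.range n) := by
      intro e he p hp
      rcases List.mem_cons.1 hp with rfl | hp
      · exact mem_lits.2 ⟨hr, he⟩
      · exact hX3 p hp
    have key : ∀ e : ℤ, (e = 1 ∨ e = -1) →
        S.SparseLits (litSet n (litClosure A (List.range n) ((r, e) :: X))) →
        ∀ X', X' = litClosure A (List.range n) ((r, e) :: X) → S.ClosedLits (litSet n X') ∧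
        S.SparseLits (litSet n X') ∧ (∀ p ∈ X', p ∈ lits (List.range n)) ∧
        ∀ j : Fin n, (j : ℕ) < r + 1 → Touched (litSet n X') j := by
      rintro e he hsp X' rfl
      have hsub := subset_litClosure (A := A) (hpsub e he)
      refine ⟨closed_litClosure hA hent hu _, hsp,
        fun p hp => (listClosure_sublist _ _ _).subset hp, fun j hj => ?_⟩
      rcases Nat.lt_succ_iff_lt_or_eq.1 hj with hj | hj
      · exact (hX4 j hj).imp (fun h => hsub _ (List.mem_cons_of_mem _ h))
          (fun h => hsub _ (List.mem_cons_of_mem _ h))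
      · have : ((j : ℕ), e) ∈ litClosure A (List.range n) ((r, e) :: X) := by
          rw [hj]
          exact hsub (r, e) (by simp)
        rcases he with rfl | rfl
        exacts [.inl this, .inr this]
    unfold greedyStep
    cases ht : memLit X r 1 || memLit X r (-1) with
    | true =>
      rw [cond_true]
      refine ⟨hX1, hX2, hX3, fun j hj => ?_⟩
      rcases Nat.lt_succ_iff_lt_or_eq.1 hj with hj | hj
      · exact hX4 j hj
      · rw [← hj, Bool.or_eq_true, memLit_iff, memLit_iff] at ht
        exact ht
    | false =>
      rw [cond_false]
      cases hsp : sparse A (List.range n) (litClosure A (List.range n) ((r, 1) :: X)) with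
      | true =>
        rw [cond_true]
        exact key 1 (.inl rfl) ((sparse_iff hA hent).1 hsp) _ rfl
      | false =>
        rw [cond_false]
        refine key (-1) (.inr rfl) ?_ _ rfl
        -- `W` contains a literal of `r`, and the closure of that literal together with `X` stays
        -- inside `W`, hence is sparse. If `(r, 1)` fails, it must be `(r, -1)`.
        obtain ⟨W, hXW, hW1, hW2, hW3⟩ := exists_extension hu hX1 hX2 hY hY' hYt
        have hins : ∀ e : ℤ, ((⟨r, hr⟩ : Fin n), e) ∈ W →
            S.SparseLits (litSet n (litClosure A (List.range n) ((r, e) :: X))) := fun e he => by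
          refine hW2.mono (litClosure_subset hA hent hW1 ?_)
          rintro ⟨j, f⟩ hj
          rcases List.mem_cons.1 (mem_litSet.1 hj) with h | h
          · obtain ⟨h1, rfl⟩ := Prod.mk_inj.1 h
            have : j = ⟨r, hr⟩ := Fin.ext h1
            rwa [this]
          · exact hXW h
        refine hins (-1) ((hW3 ⟨r, hr⟩).resolve_left fun h => ?_)
        rw [(sparse_iff hA hent).2 (hins 1 h)] at hsp
        exact absurd hsp (by simp)

omit hA hent in
theorem labels_getD (j : Fin n) :
    (labels A (List.range n)).getD j 0 = labelOf (litSet n (greedy A (List.range n))) j := by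
  classical
  rw [labels, getD_map_range, labelOf]
  simp only [mem_litSet, ← memLit_iff, Bool.cond_eq_ite]

end

theorem foldl_min_spec (l : List ℤ) (c : ℤ) :
    l.foldl min c ≤ c ∧ (∀ x ∈ l, l.foldl min c ≤ x) ∧ (l.foldl min c = c ∨ l.foldl min c ∈ l) := by
  induction l generalizing c with
  | nil => simp
  | cons x l ih =>
    obtain ⟨h1, h2, h3⟩ := ih (min c x)
    rw [List.foldl_cons]
    refine ⟨h1.trans (min_le_left _ _), fun y hy => ?_, ?_⟩
    · rcases List.mem_cons.1 hy with rfl | hy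
      exacts [h1.trans (min_le_right _ _), h2 y hy]
    · rcases h3 with h3 | h3
      · rcases min_choice c x with h | h <;> rw [h] at h3 ⊢ <;> simp [h3]
      · exact .inr (List.mem_cons_of_mem _ h3)

/-! ### Correctness of the list functions for the descent. -/

section

variable {m n : ℕ} {S : IntSys (Fin m) (Fin n)} {A : List (List (ℤ × ℤ))} {b : List (ℤ × ℤ)}
  (hA : A.length = m) (hent : ∀ (i : Fin m) (j : Fin n), ent A i j = S.a i j)
  (hb : ∀ i : Fin m, bnd b i = S.b i) {ε s : List ℤ} {ev sv : Fin n → ℤ}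
  (hεv : ∀ j : Fin n, ε.getD j 0 = ev j) (hsv : ∀ j : Fin n, s.getD j 0 = sv j)

include hεv hsv

theorem capL_eq (j : Fin n) : capL S.d ε s j = S.cap ev sv j := by
  simp only [capL, cap, hεv, hsv, Bool.cond_decide]

include hent hb

omit hεv in
theorem slackL_eq (i : Fin m) : slackL A b (List.range n) s i = S.slack sv i := by
  simp only [slackL, slack, sum_map_range, hent, hsv, hb]

theorem costL_eq {z : List ℤ} {zv : Fin n → ℤ} (hz : ∀ j : Fin n, z.getD j 0 = zv j) (i : Fin m) :
    costL A b (List.range n) ε s z i = S.cost ev sv zv i := by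
  simp only [costL, cost, slackL_eq hent hb hsv, sum_map_range, hent, hεv, hz, Bool.cond_decide]

include hA

theorem activeStep_iff {X : List ℕ} {j : Fin n} :
    activeStep A b S.d (List.range n) ε s X j = true ↔ (j : ℕ) ∈ X ∨ (0 < S.cap ev sv j ∧
      ∀ i, S.a i j * ev j = 1 → 0 < S.slack sv i ∨ ∃ k : Fin n, S.a i k * ev k = -1 ∧ (k : ℕ) ∈ X) := by
  subst hA
  simp only [activeStep, Bool.or_eq_true, Bool.and_eq_true, Bool.not_eq_true', any_range,
    all_range, memIdx_iff, decide_eq_true_eq, decide_eq_false_iff_not, hent, hεv,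
    slackL_eq hent hb hsv, capL_eq hεv hsv, imp_iff_not_or]

/-- The computed set is a fixed point of the activity rule. Thus an inactive coordinate with
positive capacity has a blocking row without slack whose body is inactive. -/
theorem mem_active_iff {j : Fin n} : (j : ℕ) ∈ active A b S.d (List.range n) ε s ↔
    0 < S.cap ev sv j ∧ ∀ i, S.a i j * ev j = 1 → 0 < S.slack sv i ∨
      ∃ k : Fin n, S.a i k * ev k = -1 ∧ (k : ℕ) ∈ active A b S.d (List.range n) ε s := by
  have hfix := filter_listClosure (U := List.range n) (F := activeStep A b S.d (List.range n) ε s)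
    (X := []) fun X p hp => by
      unfold activeStep
      rw [memIdx_iff.2 hp, Bool.true_or]
  change (List.range n).filter (activeStep A b S.d (List.range n) ε s
    (active A b S.d (List.range n) ε s)) = active A b S.d (List.range n) ε s at hfix
  constructor
  · have := listClosure_invariant (U := List.range n)
      (F := activeStep A b S.d (List.range n) ε s) (X := [])
      (fun X => ∀ j : Fin n, (j : ℕ) ∈ X → 0 < S.cap ev sv j ∧ ∀ i, S.a i j * ev j = 1 →
        0 < S.slack sv i ∨ ∃ k : Fin n, S.a i k * ev k = -1 ∧ (k : ℕ) ∈ X)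
      (by simp) (fun X hX j hj => by
        have hj' := (activeStep_iff hA hent hb hεv hsv).1 (List.mem_filter.1 hj).2
        have hsub : ∀ k : Fin n, (k : ℕ) ∈ X →
            (k : ℕ) ∈ (List.range n).filter (activeStep A b S.d (List.range n) ε s X) :=
          fun k hk => List.mem_filter.2 ⟨List.mem_range.2 k.2,
            (activeStep_iff hA hent hb hεv hsv).2 (.inl hk)⟩
        obtain ⟨h1, h2⟩ : 0 < S.cap ev sv j ∧ ∀ i, S.a i j * ev j = 1 →
            0 < S.slack sv i ∨ ∃ k : Fin n, S.a i k * ev k = -1 ∧ (k : ℕ) ∈ X := by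
          rcases hj' with h | h
          exacts [hX j h, h]
        exact ⟨h1, fun i hi => (h2 i hi).imp_right fun ⟨k, hk, hk'⟩ => ⟨k, hk, hsub k hk'⟩⟩)
    exact this j
  · intro h
    rw [← hfix]
    exact List.mem_filter.2 ⟨List.mem_range.2 j.2, (activeStep_iff hA hent hb hεv hsv).2 (.inr h)⟩

theorem active_of_mem {j : Fin n} (hj : (j : ℕ) ∈ active A b S.d (List.range n) ε s) :
    S.Active ev sv j := by
  refine listClosure_induction (U := List.range n)
    (F := activeStep A b S.d (List.range n) ε s) (X := [])
    (fun k => ∀ h : k < n, S.Active ev sv ⟨k, h⟩) (by simp) (fun X hX k _ hk h => ?_) j hj j.2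
  rcases (activeStep_iff hA hent hb hεv hsv (j := ⟨k, h⟩)).1 hk with h' | ⟨h1, h2⟩
  · exact hX k h' h
  · exact fun Q hQ => hQ _ h1 fun i hi => (h2 i hi).imp_right fun ⟨k, hk, hk'⟩ =>
      ⟨k, hk, hX k hk' k.2 Q hQ⟩

theorem valueStep_spec {c z : List ℤ} {cv zv : Fin n → ℤ} (hc : ∀ j : Fin n, c.getD j 0 = cv j)
    (hz : ∀ j : Fin n, z.getD j 0 = zv j) (hc0 : ∀ j, 0 ≤ cv j) (hz0 : ∀ j, 0 ≤ zv j)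
    (hs : S.Feas sv) (j : Fin n) (v : ℤ)
    (hv : v = (valueStep A b (List.range n) ε s c z).getD j 0) :
    v ≤ cv j ∧ (∀ i, S.a i j * ev j = 1 → v ≤ S.cost ev sv zv i) ∧
      (v = cv j ∨ ∃ i, S.a i j * ev j = 1 ∧ v = S.cost ev sv zv i) := by
  subst hA
  set l : List ℤ := (((List.range A.length).filter fun i => decide (ent A i j * ε.getD j 0 = 1)).map
    (costL A b (List.range n) ε s z)) with hl
  have hmem : ∀ x, x ∈ l ↔ ∃ i, S.a i j * ev j = 1 ∧ S.cost ev sv zv i = x := by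
    intro x
    simp only [hl, List.mem_map, List.mem_filter, List.mem_range, decide_eq_true_eq]
    constructor
    · rintro ⟨i, ⟨hi, h⟩, rfl⟩
      have h1 := hent ⟨i, hi⟩ j
      have h2 := costL_eq hent hb hεv hsv hz ⟨i, hi⟩
      dsimp only at h1 h2
      rw [h1, hεv] at h
      exact ⟨⟨i, hi⟩, h, h2.symm⟩
    · rintro ⟨i, h, rfl⟩
      exact ⟨i, ⟨i.2, by rw [hent, hεv, h]⟩, costL_eq hent hb hεv hsv hz i⟩
  obtain ⟨h1, h2, h3⟩ := foldl_min_spec l (cv j)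
  -- Start values and costs are nonnegative here, so the truncation at `0` disappears.
  have hv' : v = l.foldl min (cv j) := by
    rw [hv, valueStep, getD_map_range, hc, max_eq_right]
    change 0 ≤ l.foldl min (cv j)
    rcases h3 with h3 | h3
    · rw [h3]; exact hc0 j
    · obtain ⟨i, -, hi⟩ := (hmem _).1 h3
      rw [← hi]
      exact add_nonneg (slack_nonneg hs i)
        (Finset.sum_nonneg fun k _ => by split_ifs; exacts [hz0 k, le_rfl])
  rw [hv']
  refine ⟨h1, fun i hi => h2 _ ((hmem _).2 ⟨i, hi, rfl⟩), h3.imp_right fun h => ?_⟩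
  obtain ⟨i, hi, h⟩ := (hmem _).1 h
  exact ⟨i, hi, h.symm⟩

end

end ReconfAlg

/-! ### Correctness of the descent, of the moves and of the decision. -/

namespace ReconfAlg

open IntSys

theorem getD_ofFn {n : ℕ} (v : Fin n → ℤ) (j : Fin n) : (List.ofFn v).getD j 0 = v j := by
  simp [List.getD_eq_getElem?_getD]

section

variable {m n : ℕ} {S : IntSys (Fin m) (Fin n)} {A : List (List (ℤ × ℤ))} {b : List (ℤ × ℤ)}
  (hA : A.length = m) (hent : ∀ (i : Fin m) (j : Fin n), ent A i j = S.a i j)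
  (hb : ∀ i : Fin m, bnd b i = S.b i) {ε s t : List ℤ} {ev sv tv : Fin n → ℤ}
  (hεv : ∀ j : Fin n, ε.getD j 0 = ev j) (hsv : ∀ j : Fin n, s.getD j 0 = sv j)
  (htv : ∀ j : Fin n, t.getD j 0 = tv j)

include hA hent hb hsv

section Descend

include hεv

theorem descend_spec (hε : S.IsLabeling ev) (hu : S.IsUnit) (hs : S.Feas sv) :
    ∃ mv : Fin n → ℤ, (∀ j : Fin n, (descend A b S.d (List.range n) ε s).getD j 0 = mv j) ∧
      S.Joined sv mv ∧ ∀ x, S.Joined sv x → ∀ j, ev j ≠ 0 → ev j * mv j ≤ ev j * x j := by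
  classical
  set P := active A b S.d (List.range n) ε s with hP
  set cv : Fin n → ℤ := fun j => if (j : ℕ) ∈ P then S.cap ev sv j else 0 with hcv
  have hcap := fun j => cap_nonneg (S := S) (ε := ev) hs j
  have hc0 : ∀ j, 0 ≤ cv j := fun j => by
    simp only [hcv]; split_ifs; exacts [hcap j, le_rfl]
  have hcle : ∀ j, cv j ≤ S.cap ev sv j := fun j => by
    simp only [hcv]; split_ifs; exacts [le_rfl, hcap j]
  have hstart : startValues A b S.d (List.range n) ε s = List.ofFn cv := by
    rw [startValues, map_range_eq_ofFn]
    congr 1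
    funext j
    rw [capL_eq hεv hsv, Bool.cond_eq_ite, hcv]
    simp only [memIdx_iff]
    rfl
  set F : (Fin n → ℤ) → Fin n → ℤ := fun z j =>
    (valueStep A b (List.range n) ε s (List.ofFn cv) (List.ofFn z)).getD j 0 with hF
  have hstep : ∀ z : Fin n → ℤ,
      valueStep A b (List.range n) ε s (List.ofFn cv) (List.ofFn z) = List.ofFn (F z) := fun z => by
    have : ∀ f : ℕ → ℤ, (List.range n).map f
        = List.ofFn fun j : Fin n => ((List.range n).map f).getD j 0 := fun f => by
      rw [map_range_eq_ofFn]
      congr 1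
      funext j
      rw [getD_ofFn]
    exact this _
  have hvalues : values A b S.d (List.range n) ε s = List.ofFn (F^[n] cv) := by
    rw [values, hstart, List.foldl_const, List.length_range]
    have : ∀ r, (fun z => valueStep A b (List.range n) ε s (List.ofFn cv) z)^[r] (List.ofFn cv)
        = List.ofFn (F^[r] cv) := by
      intro r
      induction r with
      | zero => rfl
      | succ r ih => rw [Function.iterate_succ_apply', ih, hstep, Function.iterate_succ_apply']
    exact this n
  have hspec := fun (z : Fin n → ℤ) (j : Fin n) (hz : ∀ j, 0 ≤ z j) =>
    valueStep_spec hA hent hb hεv hsv (getD_ofFn cv) (getD_ofFn z) hc0 hz hs j (F z j) rfl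
  obtain ⟨hfix, hz0⟩ := iterate_stationary (S := S) (ε := ev) (F := F) hs hc0
    (fun z j hz => (hspec z j hz).1) (fun z i j hz => (hspec z j hz).2.1 i)
    (fun z j hz => (hspec z j hz).2.2)
  rw [Fintype.card_fin] at hfix hz0
  set z := F^[n] cv with hz
  have hzspec := fun j => hspec z j hz0
  rw [hfix] at hzspec
  have hzP : ∀ j : Fin n, (j : ℕ) ∉ P → z j = 0 := fun j hj => by
    have := (hzspec j).1
    simp only [hcv, hj, if_false] at this
    exact le_antisymm this (hz0 j)
  -- The start values vanish outside `P`, but the bound is needed with the true capacity. For a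
  -- coordinate outside `P`, either this capacity is 0, or some row with this head has cost 0
  -- because its slack and all displacements in its body vanish.
  have hpre : ∀ j, z j = S.cap ev sv j ∨ ∃ i, S.a i j * ev j = 1 ∧ S.cost ev sv z i ≤ z j := by
    intro j
    by_cases hj : (j : ℕ) ∈ P
    · refine (hzspec j).2.2.imp (fun h => ?_) fun ⟨i, hi, h⟩ => ⟨i, hi, h.ge⟩
      rw [h]; simp only [hcv, hj, if_true]
    · have hj' := mt (mem_active_iff hA hent hb hεv hsv).2 hj
      rw [hzP j hj]
      rw [not_and_or] at hj'
      rcases hj' with h | h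
      · exact .inl (le_antisymm (hcap j) (not_lt.1 h))
      · push Not at h
        obtain ⟨i, hi, h1, h2⟩ := h
        refine .inr ⟨i, hi, ?_⟩
        have : ∑ k, (if S.a i k * ev k = -1 then z k else 0) = 0 :=
          Finset.sum_eq_zero fun k _ => by
            split_ifs with hk
            · exact hzP k (h2 k hk)
            · rfl
        rw [cost, this, add_zero]
        exact h1
  have hpost : ∀ i j, S.a i j * ev j = 1 → z j ≤ S.cost ev sv z i := fun i j => (hzspec j).2.1 i
  have hact : ∀ j, z j = 0 ∨ S.Active ev sv j := fun j => by
    by_cases hj : (j : ℕ) ∈ P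
    · exact .inr (active_of_mem hA hent hb hεv hsv hj)
    · exact .inl (hzP j hj)
  refine ⟨fun j => sv j - ev j * z j, fun j => ?_,
    hε.joined_descent hs hz0 (fun j => (hzspec j).1.trans (hcle j)) hpre hpost hact hu,
    fun x hx j hj => ?_⟩
  · rw [descend, getD_map_range, hsv, hεv, hvalues, getD_ofFn]
  · have h1 := hε.displacement_le hs hpre hu hz0 hx j hj
    rcases hε.val j with h | h | h
    · exact absurd h hj
    all_goals
      dsimp only
      rw [h] at h1 ⊢
      linarith

end Descend

include htv

omit hA hent hb in
theorem movedL_eq (X : List ℕ) (k : Fin n) :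
    movedL s t X k = moved sv tv (Finset.univ.filter fun j : Fin n => (j : ℕ) ∈ X) k := by
  simp only [movedL, moved, sgn, hsv, htv, Finset.mem_filter, Finset.mem_univ, true_and,
    Bool.cond_eq_ite, memIdx_iff, decide_eq_true_eq]
  unfold clamp
  split_ifs <;> omega

theorem moveStep_iff (hs : S.Feas sv) (ht : S.Feas tv) {X : List ℕ} {j : Fin n} :
    moveStep A b (List.range n) s t X j = true ↔ (j : ℕ) ∈ X ∨ (sv j ≠ tv j ∧
      S.Feas (moved sv tv (insert j (Finset.univ.filter fun j : Fin n => (j : ℕ) ∈ X)))) := by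
  subst hA
  have hset : (Finset.univ.filter fun k : Fin n => (k : ℕ) ∈ (j : ℕ) :: X)
      = insert j (Finset.univ.filter fun j : Fin n => (j : ℕ) ∈ X) := by
    ext k
    simp [Fin.val_inj]
  -- Moved vectors lie between `s` and `t`, which is why the program tests the rows only.
  have hbox : ∀ M : Finset (Fin n), ∀ j, 0 ≤ moved sv tv M j ∧ moved sv tv M j ≤ S.d := fun M j => by
    have h1 := hs.1 j
    have h2 := ht.1 j
    unfold moved clamp; split_ifs <;> omega
  simp only [moveStep, Bool.or_eq_true, Bool.and_eq_true, Bool.not_eq_true', all_range,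
    memIdx_iff, decide_eq_true_eq, decide_eq_false_iff_not, hent, hb, hsv, htv, sum_map_range,
    movedL_eq hsv htv, hset, Feas, ne_eq]
  simp only [← hset, hbox, implies_true, true_and]

theorem joinedL_spec [Nonempty (Fin n)] (hεv : ∀ j : Fin n, ε.getD j 0 = ev j)
    (hε : S.IsLabeling ev) (hu : S.IsUnit) (hs : S.Feas sv) (ht : S.Feas tv)
    (hlow : ∀ x, S.Joined sv x → ∀ j, ev j ≠ 0 → ev j * sv j ≤ ev j * x j) :
    joinedL A b (List.range n) ε s t = true ↔
      (∀ j, ev j ≠ 0 → sv j = tv j) ∧ S.Joined sv tv := by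
  have h1 : joinedL A b (List.range n) ε s t = true ↔ (∀ j, ev j ≠ 0 → sv j = tv j) ∧
      ∀ j : Fin n, sv j ≠ tv j → (j : ℕ) ∈ moves A b (List.range n) s t := by
    simp only [joinedL, Bool.and_eq_true, Bool.or_eq_true, all_range, decide_eq_true_eq,
      memIdx_iff, hεv, hsv, htv, ne_eq, or_iff_not_imp_left]
  rw [h1]
  refine and_congr_right fun hst => ?_
  have hinf : ∀ X, ∀ p ∈ X, moveStep A b (List.range n) s t X p = true := fun X p hp => by
    unfold moveStep
    rw [memIdx_iff.2 hp, Bool.true_or]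
  have hfix := filter_listClosure (U := List.range n) (X := []) hinf
  change (List.range n).filter (moveStep A b (List.range n) s t (moves A b (List.range n) s t))
    = moves A b (List.range n) s t at hfix
  have hJ : S.Joined sv (moved sv tv
      (Finset.univ.filter fun j : Fin n => (j : ℕ) ∈ moves A b (List.range n) s t)) := by
    refine listClosure_invariant (U := List.range n) (F := moveStep A b (List.range n) s t) (X := [])
      (fun X => S.Joined sv (moved sv tv (Finset.univ.filter fun j : Fin n => (j : ℕ) ∈ X))) ?_ ?_
    · have : moved sv tv (Finset.univ.filter fun j : Fin n => (j : ℕ) ∈ ([] : List ℕ)) = sv := by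
        funext j; simp [moved]
      rw [this]
      exact .refl hs
    · intro X hX
      -- One round inserts all admissible coordinates at once. Each is feasible on its own with the
      -- old set, so closure under union lets them be moved one after the other.
      set Y := (Finset.univ.filter fun j : Fin n => (j : ℕ) ∉ X ∧
        moveStep A b (List.range n) s t X j = true) with hY
      have h2 := hε.joined_moved_union hu hs ht hst hX Y fun j hj => by
        simp only [hY, Finset.mem_filter, Finset.mem_univ, true_and] at hj
        exact (((moveStep_iff hA hent hb hsv htv hs ht).1 hj.2).resolve_left hj.1).2
      convert h2 using 2
      ext j
      simp only [hY, Finset.mem_filter, Finset.mem_univ, true_and, List.mem_filter, List.mem_range,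
        j.2, Finset.mem_union]
      constructor
      · intro h
        by_cases hj : (j : ℕ) ∈ X
        exacts [.inl hj, .inr ⟨hj, h⟩]
      · rintro (h | h)
        exacts [hinf X j h, h.2]
  rw [hε.joined_one_iff hu hs ht hst hlow hJ fun j hj hfeas => ?_]
  · simp
  · simp only [Finset.mem_filter, Finset.mem_univ, true_and]
    rw [← hfix]
    exact List.mem_filter.2 ⟨List.mem_range.2 j.2,
      (moveStep_iff hA hent hb hsv htv hs ht).2 (.inr ⟨hj, hfeas⟩)⟩

theorem solve_spec [Nonempty (Fin n)] (hu : S.IsUnit)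
    (hsol : ∃ Y : Set (Fin n × ℤ), S.ClosedLits Y ∧ S.SparseLits Y ∧ ∀ j, Touched Y j)
    (hs : S.Feas sv) (ht : S.Feas tv) (hlen : s.length = n) (x₁ x₂ : ℕ) :
    solve (x₁, x₂, A, b, S.d, s, t) = true ↔ S.Joined sv tv := by
  obtain ⟨hX1, hX2, hX3⟩ := greedy_spec hA hent hu hsol
  have hε := isLabeling_labelOf hu hX1 hX2 hX3
  have hεv := labels_getD (A := A) (n := n)
  obtain ⟨ms, hms, hJs, hls⟩ := descend_spec hA hent hb hεv hsv hε hu hs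
  obtain ⟨mt, hmt, hJt, hlt⟩ := descend_spec hA hent hb hεv htv hε hu ht
  simp only [solve, hlen]
  rw [joinedL_spec hA hent hb hms hmt hεv hε hu hJs.2.1 hJt.2.1 fun x hx => hls x (hJs.trans hx)]
  constructor
  · rintro ⟨-, h⟩
    exact hJs.trans (h.trans hJt.symm)
  · intro h
    -- The two least points lie in one component, so each is below the other on the labelled
    -- coordinates.
    refine ⟨fun j hj => ?_, hJs.symm.trans (h.trans hJt)⟩
    have h1 := hls mt (h.trans hJt) j hj
    have h2 := hlt ms (h.symm.trans hJs) j hj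
    exact mul_left_cancel₀ hj (le_antisymm h1 h2)

end

end ReconfAlg

/-! ## Integer linear systems -/

namespace ILS

/-- The integer system that is equivalent to a unit system. -/
def toIntSys (I : ILS) : IntSys (Fin I.m) (Fin I.n) where
  a i j := (I.A i j).num
  b i := ⌈I.b i⌉
  d := I.d

variable {I : ILS}

instance : Nonempty (Fin I.n) := ⟨⟨0, I.n_pos⟩⟩

theorem IsUnit.toIntSys (hu : I.IsUnit) : I.toIntSys.IsUnit := fun i j => by
  rcases hu i j with h | h | h <;> simp [ILS.toIntSys, h]

theorem IsUnit.cast_a (hu : I.IsUnit) (i : Fin I.m) (j : Fin I.n) :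
    ((I.toIntSys.a i j : ℤ) : ℚ) = I.A i j := by
  rcases hu i j with h | h | h <;> simp [ILS.toIntSys, h]

/-- The row values are integers, so rounding `b` up loses no solution. -/
theorem IsUnit.isFeasible_iff (hu : I.IsUnit) (x : Fin I.n → ℤ) :
    I.IsFeasible x ↔ I.toIntSys.Feas x := by
  refine and_congr Iff.rfl (forall_congr' fun i => ?_)
  have h : (I.A *ᵥ fun j => (x j : ℚ)) i = ((∑ j, I.toIntSys.a i j * x j : ℤ) : ℚ) := by
    simp only [Matrix.mulVec, dotProduct, Int.cast_sum, Int.cast_mul, hu.cast_a]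
  rw [h]
  exact Int.ceil_le.symm

theorem IsUnit.reachable_iff (hu : I.IsUnit) (x y : Fin I.n → ℤ) :
    I.Reachable x y ↔ I.toIntSys.Joined x y := by
  constructor
  · rintro ⟨hx, hy, h⟩
    rw [SimpleGraph.reachable_iff_reflTransGen] at h
    refine ⟨(hu.isFeasible_iff x).1 hx, (hu.isFeasible_iff y).1 hy, ?_⟩
    refine Relation.ReflTransGen.lift (p := I.toIntSys.Step)
      (fun v : {x // I.IsFeasible x} => v.1) ?_ _ _ h
    intro v w hvw
    refine ⟨(hu.isFeasible_iff _).1 v.2, (hu.isFeasible_iff _).1 w.2, ?_⟩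
    obtain ⟨j, hj⟩ := Finset.card_eq_one.1 (show hammingDist v.1 w.1 = 1 from hvw)
    refine ⟨j, fun k hk => ?_⟩
    by_contra h
    have : k ∈ ({j} : Finset (Fin I.n)) := hj ▸ by simpa using h
    exact hk (Finset.mem_singleton.1 this)
  · intro h
    refine IntSys.Joined.induction (C := fun y => I.Reachable x y)
      ⟨(hu.isFeasible_iff x).2 h.1, (hu.isFeasible_iff x).2 h.1, .refl _⟩ ?_ h
    rintro v w - ⟨hv, hw, j, hj⟩ ⟨hx, hv', h⟩
    refine ⟨hx, (hu.isFeasible_iff w).2 hw, ?_⟩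
    -- `Step` allows equality, adjacency does not.
    by_cases hvw : v = w
    · subst hvw; exact h
    refine h.trans (SimpleGraph.Adj.reachable ?_)
    refine Finset.card_eq_one.2 ⟨j, ?_⟩
    ext k
    simp only [Finset.mem_filter, Finset.mem_univ, true_and, Finset.mem_singleton]
    constructor
    · intro h
      by_contra hk
      exact h (hj k hk)
    · rintro rfl h
      exact hvw (funext fun l => by
        by_cases hl : l = k
        · rw [hl, h]
        · exact hj l hl)

/-! ### The complexity index -/

theorem inILS_of_indexLPFeasible {γ : ℝ} {α : Fin I.n → ℝ} (h : I.IndexLPFeasible γ α) :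
    I.InILS γ := by
  refine csInf_le ⟨0, ?_⟩ ⟨α, h⟩
  rintro Z ⟨β, hβ, hZ⟩
  refine le_trans (add_nonneg ?_ ?_) (hZ ⟨0, I.m_pos⟩)
  · exact Finset.sum_nonneg fun j _ => (hβ j).1
  · exact Finset.sum_nonneg fun j _ => sub_nonneg.2 (hβ j).2

/-- The largest row sum is continuous on the compact cube, so the infimum is attained. -/
theorem InILS.exists_indexLPFeasible {γ : ℝ} (h : I.InILS γ) : ∃ α, I.IndexLPFeasible γ α := by
  have : Nonempty (Fin I.m) := ⟨⟨0, I.m_pos⟩⟩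
  set g : (Fin I.n → ℝ) → ℝ := fun α => Finset.univ.sup' Finset.univ_nonempty fun i : Fin I.m =>
    ∑ j with 0 < I.A i j, α j + ∑ j with I.A i j < 0, (1 - α j) with hg
  have hcont : Continuous g := by
    refine Continuous.finset_sup'_apply _ fun i _ => ?_
    fun_prop
  have hK : IsCompact (Set.Icc (0 : Fin I.n → ℝ) 1) := isCompact_Icc
  obtain ⟨α, hα, hmin⟩ := hK.exists_isMinOn ⟨0, by simp⟩ hcont.continuousOn
  have hfeas : I.IndexLPFeasible (g α) α :=
    ⟨fun j => ⟨hα.1 j, hα.2 j⟩, fun i => Finset.le_sup' (fun i : Fin I.m =>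
      ∑ j with 0 < I.A i j, α j + ∑ j with I.A i j < 0, (1 - α j)) (Finset.mem_univ i)⟩
  have hle : g α ≤ I.complexityIndex := by
    refine le_csInf ⟨g α, α, hfeas⟩ ?_
    rintro Z ⟨β, hβ, hZ⟩
    refine le_trans (hmin (show β ∈ Set.Icc 0 1 from ⟨fun j => (hβ j).1, fun j => (hβ j).2⟩)) ?_
    exact Finset.sup'_le _ _ fun i _ => hZ i
  exact ⟨α, hfeas.1, fun i => (hfeas.2 i).trans (hle.trans h)⟩

theorem IsHorn.inILS (h : I.IsHorn) : I.InILS 1 :=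
  inILS_of_indexLPFeasible (α := fun _ => 1) ⟨fun _ => by simp, fun i => by simpa using h i⟩

theorem IsTVPI.inILS (h : I.IsTVPI) : I.InILS 1 := by
  refine inILS_of_indexLPFeasible (α := fun _ => 1 / 2) ⟨fun _ => by norm_num, fun i => ?_⟩
  have h1 : (Finset.univ.filter fun j => 0 < I.A i j).card
      + (Finset.univ.filter fun j => I.A i j < 0).card ≤ 2 := by
    rw [← Finset.card_union_of_disjoint]
    · refine (Finset.card_le_card fun j hj => ?_).trans (h i)
      simp only [Finset.mem_union, Finset.mem_filter, Finset.mem_univ, true_and] at hj ⊢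
      exact hj.elim ne_of_gt ne_of_lt
    · exact Finset.disjoint_filter.2 fun j _ h => not_lt.2 h.le
  have h2 : ((Finset.univ.filter fun j => 0 < I.A i j).card : ℝ)
      + (Finset.univ.filter fun j => I.A i j < 0).card ≤ 2 := by exact_mod_cast h1
  simp only [Finset.sum_const, nsmul_eq_mul]
  linarith

/-- Rounding a solution of the index program to a set of literals of weight at least `1/2`. -/
theorem exists_lits (hu : I.IsUnit) (h : I.InILS 1) : ∃ Y : Set (Fin I.n × ℤ),
    I.toIntSys.ClosedLits Y ∧ I.toIntSys.SparseLits Y ∧ ∀ j, IntSys.Touched Y j := by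
  classical
  obtain ⟨α, h01, hα⟩ := h.exists_indexLPFeasible
  set w : Fin I.n → ℤ → ℝ := fun j e => if e = 1 then α j else 1 - α j with hw
  have hw0 : ∀ j e, 0 ≤ w j e := fun j e => by
    have := h01 j
    simp only [hw]; split_ifs <;> linarith
  have hval : ∀ i j, I.toIntSys.a i j = 0 ∨ I.toIntSys.a i j = 1 ∨ I.toIntSys.a i j = -1 :=
    hu.toIntSys
  have hneg : ∀ i j, I.toIntSys.a i j ≠ 0 →
      w j (-I.toIntSys.a i j) = 1 - w j (I.toIntSys.a i j) := fun i j h0 => by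
    rcases hval i j with h | h | h
    · exact absurd h h0
    · simp [hw, h]
    · simp [hw, h]
  have hrow : ∀ i, ∑ j with I.toIntSys.a i j ≠ 0, w j (I.toIntSys.a i j) ≤ 1 := fun i => by
    refine le_trans (le_of_eq ?_) (hα i)
    rw [Finset.sum_filter, Finset.sum_filter, Finset.sum_filter, ← Finset.sum_add_distrib]
    refine Finset.sum_congr rfl fun j _ => ?_
    rcases hu i j with h | h | h <;> simp [ILS.toIntSys, hw, h]
  -- Two literals of a row weigh at most 1 together, so if one has weight at least 1/2, so does the
  -- negation of the other. Three literals of weight at least 1/2 would exceed 1.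
  refine ⟨{p | 1 / 2 ≤ w p.1 p.2}, fun i j k hjk hj hk hmem => ?_, fun i => ?_, fun j => ?_⟩
  · simp only [Set.mem_ofPred_eq] at hmem ⊢
    rw [hneg i j hj]
    have h1 : ∑ l ∈ {j, k}, w l (I.toIntSys.a i l) ≤
        ∑ l with I.toIntSys.a i l ≠ 0, w l (I.toIntSys.a i l) :=
      Finset.sum_le_sum_of_subset_of_nonneg (fun l hl => by
        simp only [Finset.mem_insert, Finset.mem_singleton] at hl
        rcases hl with rfl | rfl <;> simpa) fun l _ _ => hw0 _ _
    rw [Finset.sum_pair hjk] at h1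
    have := hrow i
    linarith
  · have h1 : ∑ j with (I.toIntSys.a i j ≠ 0 ∧ (j, I.toIntSys.a i j) ∈ {p : Fin I.n × ℤ | 1 / 2 ≤ w p.1 p.2}),
        (1 / 2 : ℝ) ≤ ∑ j with I.toIntSys.a i j ≠ 0, w j (I.toIntSys.a i j) := by
      refine (Finset.sum_le_sum fun j hj => ?_).trans
        (Finset.sum_le_sum_of_subset_of_nonneg (fun j hj => ?_) fun j _ _ => hw0 _ _)
      · exact (Finset.mem_filter.1 hj).2.2
      · exact Finset.mem_filter.2 ⟨Finset.mem_univ j, (Finset.mem_filter.1 hj).2.1⟩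
    rw [Finset.sum_const, nsmul_eq_mul] at h1
    have h2 := hrow i
    have h3 : ((Finset.univ.filter fun j => I.toIntSys.a i j ≠ 0 ∧
        (j, I.toIntSys.a i j) ∈ {p : Fin I.n × ℤ | 1 / 2 ≤ w p.1 p.2}).card : ℝ) ≤ 2 := by linarith
    convert (Nat.cast_le (α := ℝ)).1 (by exact_mod_cast h3)
  · by_cases h : 1 / 2 ≤ α j
    · left; simpa [hw] using h
    · right
      simp only [Set.mem_ofPred_eq, hw]
      norm_num
      linarith

end ILS

/-! ### The theorem on polynomial time -/

namespace ReconfInput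

/-- The data of an input as lists. -/
def data (x : ReconfInput) :
    ℕ × ℕ × List (List (ℤ × ℤ)) × List (ℤ × ℤ) × ℤ × List ℤ × List ℤ :=
  (x.I.m, x.I.n, List.ofFn fun i => List.ofFn fun j => ((x.I.A i j).num, ((x.I.A i j).den : ℤ)),
    List.ofFn fun i => ((x.I.b i).num, ((x.I.b i).den : ℤ)), x.I.d, List.ofFn x.s, List.ofFn x.t)

open WhileLang in
theorem enc_data (x : ReconfInput) : Enc.enc x.data = x.encode := by
  simp only [Enc.enc, data, encode, Val.ofVec, List.map_ofFn, Val.ofRat, Function.comp_def]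

theorem ent_data (x : ReconfInput) (i : Fin x.I.m) (j : Fin x.I.n) :
    ReconfAlg.ent x.data.2.2.1 i j = x.I.toIntSys.a i j := by
  simp [ReconfAlg.ent, data, List.getD_eq_getElem?_getD, ILS.toIntSys]

theorem bnd_data (x : ReconfInput) (i : Fin x.I.m) :
    ReconfAlg.bnd x.data.2.2.2.1 i = x.I.toIntSys.b i := by
  simp [ReconfAlg.bnd, data, List.getD_eq_getElem?_getD, ILS.toIntSys]
  -- The ceiling is the negated floor of the negative, and that floor is an integer division of
  -- numerator by denominator.
  rw [← neg_neg ⌈x.I.b i⌉, ← Int.floor_neg, Rat.floor_def']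
  simp

theorem solve_data (x : ReconfInput) (hu : x.I.IsUnit) (h : x.I.InILS 1) :
    ReconfAlg.solve x.data = true ↔ x.I.Reachable x.s x.t := by
  rw [hu.reachable_iff]
  exact ReconfAlg.solve_spec (by simp [data]) x.ent_data x.bnd_data (ReconfAlg.getD_ofFn x.s)
    (ReconfAlg.getD_ofFn x.t) hu.toIntSys (ILS.exists_lits hu h)
    ((hu.isFeasible_iff _).1 x.s_feasible) ((hu.isFeasible_iff _).1 x.t_feasible) (by simp) _ _

end ReconfInput

open WhileLang in
theorem polynomiallySolvable_unit_inILS :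
    PolynomiallySolvable (fun I => I.IsUnit ∧ I.InILS 1) := by
  classical
  obtain ⟨P, p, hP⟩ := ReconfAlg.polyComp_solve
  refine ⟨P, p, fun x hx => ?_⟩
  obtain ⟨k, hk, h⟩ := hP x.data
  have hs : esize x.data = x.size := by rw [esize, x.enc_data, ReconfInput.size]
  rw [hs] at hk
  refine ⟨k, hk, ?_⟩
  rw [x.enc_data] at h
  convert h using 1
  have := x.solve_data hx.1 hx.2
  by_cases hr : x.I.Reachable x.s x.t
  · simp [hr, this.2 hr, Enc.enc]
  · simp [hr, Bool.eq_false_iff.2 (mt this.1 hr), Enc.enc]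

theorem PolynomiallySolvable.mono {C D : ILS → Prop} (h : PolynomiallySolvable D)
    (hCD : ∀ I, C I → D I) : PolynomiallySolvable C := by
  obtain ⟨P, f, h⟩ := h
  exact ⟨P, f, fun x hx => h x (hCD _ hx)⟩

/-! ### Unit steps in systems with two variables per row -/

theorem ILS.moveToward_eq_clamp {n : ℕ} (s t : Fin n → ℤ) (i : ℕ) :
    ILS.moveToward s t i = fun j => IntSys.clamp i (s j) (t j) (t j) := by
  funext j
  unfold ILS.moveToward IntSys.clamp
  split_ifs <;> omega

theorem ILS.tfae_reachable_moveToward (I : ILS) (s t : Fin I.n → ℤ) (hu : I.IsUnit) (h2 : I.IsTVPI)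
    (hs : I.IsFeasible s) (ht : I.IsFeasible t) :
    [I.Reachable s t,
      ∀ i < Finset.univ.sup (fun j => (s j - t j).natAbs),
        I.Reachable (ILS.moveToward s t i) (ILS.moveToward s t (i + 1)),
      I.Reachable s (ILS.moveToward s t 1)].TFAE := by
  -- With two variables per row all weights may be 1/2. No coordinate is labelled, and the
  -- conditions on labelled coordinates are void.
  have hε : I.toIntSys.IsLabeling fun _ => 0 := by
    refine ⟨fun _ => .inl rfl, fun i j k _ h => by simp at h, fun i => ?_⟩
    refine le_trans (Finset.card_le_card fun j hj => ?_) (h2 i)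
    simpa [ILS.toIntSys] using hj
  have hu' := hu.toIntSys
  have hs' := (hu.isFeasible_iff _).1 hs
  have ht' := (hu.isFeasible_iff _).1 ht
  have hst : ∀ j, (fun _ : Fin I.n => (0 : ℤ)) j ≠ 0 → s j = t j := fun j h => absurd rfl h
  have hlow : ∀ x, I.toIntSys.Joined s x → ∀ j, (fun _ : Fin I.n => (0 : ℤ)) j ≠ 0 →
      (fun _ : Fin I.n => (0 : ℤ)) j * s j ≤ (fun _ : Fin I.n => (0 : ℤ)) j * x j :=
    fun _ _ _ h => absurd rfl h
  simp only [hu.reachable_iff, ILS.moveToward_eq_clamp]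
  have h0 : (fun j => IntSys.clamp ((0 : ℕ) : ℤ) (s j) (t j) (t j)) = s := by
    funext j; unfold IntSys.clamp; split_ifs <;> omega
  tfae_have 1 → 2 := fun h i _ => by
    have h1 := hε.joined_clamp hu' hs' ht' hst hlow h (r := (i : ℕ)) (by omega)
    have h2 := hε.joined_clamp hu' hs' ht' hst hlow h (r := (i + 1 : ℕ)) (by omega)
    exact h1.symm.trans h2
  tfae_have 2 → 3 := fun h => by
    -- If `s = t`, the list of unit steps is empty, but then the first step is `s` itself.
    rcases Nat.eq_zero_or_pos (Finset.univ.sup fun j => (s j - t j).natAbs) with hp | hp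
    · have : (fun j => IntSys.clamp ((1 : ℕ) : ℤ) (s j) (t j) (t j)) = s := by
        funext j
        have : (s j - t j).natAbs ≤ 0 :=
          hp ▸ Finset.le_sup (f := fun j => (s j - t j).natAbs) (Finset.mem_univ j)
        unfold IntSys.clamp; split_ifs <;> omega
      rw [this]
      exact .refl hs'
    · have := h 0 hp
      rwa [h0] at this
  tfae_have 3 → 1 := fun h => hε.joined_of_joined_one hu' hs' ht' hst hlow (by exact_mod_cast h)
  tfae_finish

/-! ### Exponential distances -/

namespace Corridor

/-- The system `-1 ≤ x₀ - x₁ ≤ 1` with entries between `0` and `2 ^ k`. -/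
def sys (k : ℕ) : ILS where
  m := 2
  n := 2
  m_pos := by norm_num
  n_pos := by norm_num
  A := !![1, -1; -1, 1]
  b := ![-1, -1]
  d := 2 ^ k
  d_pos := by positivity

theorem isFeasible_iff (k : ℕ) (x : Fin 2 → ℤ) : (sys k).IsFeasible x ↔
    (∀ j, 0 ≤ x j ∧ x j ≤ 2 ^ k) ∧ x 0 - x 1 ≤ 1 ∧ x 1 - x 0 ≤ 1 := by
  have : (sys k).IsFeasible x ↔ (∀ j, 0 ≤ x j ∧ x j ≤ ((2 ^ k : ℕ) : ℤ)) ∧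
    (![-1, -1] : Fin 2 → ℚ) ≤ !![1, -1; -1, 1] *ᵥ fun j => (x j : ℚ) := Iff.rfl
  rw [this]
  refine and_congr (by push_cast; rfl) ?_
  rw [Pi.le_def, Fin.forall_fin_two]
  simp only [Matrix.mulVec, dotProduct, Fin.sum_univ_two, Matrix.cons_val_zero,
    Matrix.cons_val_one, Matrix.of_apply, Matrix.cons_val', one_mul, neg_mul]
  rw [and_comm]
  refine and_congr ?_ ?_
  · rw [show -(x 0 : ℚ) + x 1 = ((-x 0 + x 1 : ℤ) : ℚ) by push_cast; ring,
      show (-1 : ℚ) = ((-1 : ℤ) : ℚ) by norm_num, Int.cast_le]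
    omega
  · rw [show (x 0 : ℚ) + -x 1 = ((x 0 + -x 1 : ℤ) : ℚ) by push_cast; ring,
      show (-1 : ℚ) = ((-1 : ℤ) : ℚ) by norm_num, Int.cast_le]
    omega

/-- The two ends of the corridor. -/
def input (k : ℕ) : ReconfInput where
  I := sys k
  s := fun _ => 0
  t := fun _ => 2 ^ k
  s_feasible := (isFeasible_iff k fun _ => 0).2 (by simp)
  t_feasible := (isFeasible_iff k fun _ => 2 ^ k).2 (by simp)

theorem isUnit (k : ℕ) : (sys k).IsUnit := by
  intro i j
  change Fin 2 at i j
  fin_cases i <;> fin_cases j <;> simp [sys]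

theorem isHorn (k : ℕ) : (sys k).IsHorn := by
  intro i
  change Fin 2 at i
  have : ∀ i : Fin 2, (Finset.univ.filter fun j : Fin 2 =>
      0 < (!![1, -1; -1, 1] : Matrix (Fin 2) (Fin 2) ℚ) i j).card ≤ 1 := by decide
  exact this i

theorem isTVPI (k : ℕ) : (sys k).IsTVPI := fun _ =>
  (Finset.card_le_univ _).trans (Fintype.card_fin 2).le

theorem reachable (k : ℕ) : (input k).I.Reachable (input k).s (input k).t := by
  refine ((isUnit k).reachable_iff _ _).2 ?_
  have hf : ∀ x : Fin 2 → ℤ, (∀ j, 0 ≤ x j ∧ x j ≤ 2 ^ k) ∧ x 0 - x 1 ≤ 1 ∧ x 1 - x 0 ≤ 1 →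
      (sys k).toIntSys.Feas x := fun x hx =>
    ((isUnit k).isFeasible_iff x).1 ((isFeasible_iff k x).2 hx)
  have H : ∀ r : ℕ, r ≤ 2 ^ k → (sys k).toIntSys.Joined (fun _ => 0 : Fin 2 → ℤ)
      (fun _ => r : Fin 2 → ℤ) := by
    intro r
    induction r with
    | zero => exact fun _ => .refl (hf _ (by simp))
    | succ r ih =>
      intro hr
      have hr' : (r : ℤ) + 1 ≤ 2 ^ k := by exact_mod_cast hr
      have h1 := ih (by omega)
      have hm : (sys k).toIntSys.Feas (![r + 1, r] : Fin 2 → ℤ) :=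
        hf _ ⟨by rw [Fin.forall_fin_two]; simp; omega, by simp⟩
      have ht : (sys k).toIntSys.Feas (fun _ => ((r + 1 : ℕ) : ℤ) : Fin 2 → ℤ) :=
        hf _ ⟨by rw [Fin.forall_fin_two]; push_cast; omega, by simp⟩
      refine (h1.trans (IntSys.Step.joined ⟨h1.2.1, hm, (0 : Fin 2), ?_⟩)).trans
        (IntSys.Step.joined ⟨hm, ht, (1 : Fin 2), ?_⟩)
      · exact (Fin.forall_fin_two (p := fun l => l ≠ 0 → (r : ℤ) = (![r + 1, r] : Fin 2 → ℤ) l)).2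
          (by simp)
      · exact (Fin.forall_fin_two (p := fun l => l ≠ 1 →
          (![r + 1, r] : Fin 2 → ℤ) l = ((r + 1 : ℕ) : ℤ))).2 (by simp)
  have := H (2 ^ k) le_rfl
  push_cast at this
  exact this

theorem sub_le_length {V : Type*} {G : SimpleGraph V} (f : V → ℤ) {c : ℤ}
    (hf : ∀ x y, G.Adj x y → f y - f x ≤ c) {x y : V} (p : G.Walk x y) :
    f y - f x ≤ c * p.length := by
  induction p with
  | nil => simp
  | cons h p ih =>
    have := hf _ _ h
    rw [SimpleGraph.Walk.length_cons, Nat.cast_succ, mul_add, mul_one]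
    linarith

/-- The unchanged coordinate confines the other one to a window of length 2. -/
theorem add_sub_add_le (k : ℕ) (x y : {x : Fin 2 → ℤ // (sys k).IsFeasible x})
    (h : hammingDist x.1 y.1 = 1) : (y.1 0 + y.1 1) - (x.1 0 + x.1 1) ≤ 2 := by
  have h1 := ((isFeasible_iff k x.1).1 x.2).2
  have h2 := ((isFeasible_iff k y.1).1 y.2).2
  have h3 : x.1 0 = y.1 0 ∨ x.1 1 = y.1 1 := by
    by_contra! h4
    have h5 : hammingDist x.1 y.1 = 2 := by
      have : (Finset.univ.filter fun i : Fin 2 => x.1 i ≠ y.1 i) = Finset.univ := by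
        rw [Finset.filter_eq_self]
        intro i _
        exact (Fin.forall_fin_two (p := fun i => x.1 i ≠ y.1 i)).2 h4 i
      exact (congrArg Finset.card this).trans (by simp)
    omega
  omega

theorem le_dist (k : ℕ) : 2 ^ k ≤ (input k).I.solutionGraph.dist
    ⟨(input k).s, (input k).s_feasible⟩ ⟨(input k).t, (input k).t_feasible⟩ := by
  obtain ⟨hs, ht, h⟩ := reachable k
  obtain ⟨p, hp⟩ := h.exists_walk_length_eq_dist
  have h1 := sub_le_length (G := (input k).I.solutionGraph)
    (fun v => v.1 (0 : Fin 2) + v.1 (1 : Fin 2)) (add_sub_add_le k) p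
  have h2 : ((2 : ℤ) ^ k + 2 ^ k) - (0 + 0) ≤ 2 * (p.length : ℤ) := h1
  rw [← hp]
  zify
  omega

theorem size_eq (k : ℕ) : (input k).size = 3 * k + 68 := by
  have h : Nat.size 2 = 2 := Nat.size_pow (n := 1)
  simp [ReconfInput.size, ReconfInput.encode, input, sys, WhileLang.Val.ofVec, WhileLang.Val.ofList,
    WhileLang.Val.size, WhileLang.Val.ofRat, List.ofFn_succ, Int.natAbs_pow, Nat.size_pow, h]
  omega

end Corridor

theorem exponential_dist : ∃ c : ℕ, 0 < c ∧ ∀ N : ℕ, ∃ x : ReconfInput, N ≤ x.size ∧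
    x.I.IsUnit ∧ x.I.InILS 1 ∧ x.I.IsHorn ∧ x.I.IsTVPI ∧ x.I.Reachable x.s x.t ∧
    2 ^ x.size ≤
      (x.I.solutionGraph.dist ⟨x.s, x.s_feasible⟩ ⟨x.t, x.t_feasible⟩) ^ c := by
  -- The input size is `3 * k + 68`, at most `71 * k` for `k = N + 1 ≥ 1`.
  refine ⟨71, by norm_num, fun N => ⟨Corridor.input (N + 1), ?_, Corridor.isUnit _,
    (Corridor.isHorn _).inILS, Corridor.isHorn _, Corridor.isTVPI _, Corridor.reachable _, ?_⟩⟩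
  · rw [Corridor.size_eq]
    omega
  · refine le_trans ?_ (Nat.pow_le_pow_left (Corridor.le_dist (N + 1)) 71)
    rw [← pow_mul, Corridor.size_eq]
    exact Nat.pow_le_pow_right (by norm_num) (by omega)

theorem mainTheorem6 :
    PolynomiallySolvable (fun I => I.IsUnit ∧ I.InILS 1) ∧
    PolynomiallySolvable (fun I => I.IsUnit ∧ I.IsHorn) ∧
    PolynomiallySolvable (fun I => I.IsUnit ∧ I.IsTVPI) ∧
    (∀ (I : ILS) (s t : Fin I.n → ℤ), I.IsUnit → I.IsTVPI → I.IsFeasible s → I.IsFeasible t →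
      [I.Reachable s t,
        ∀ i < Finset.univ.sup (fun j => (s j - t j).natAbs),
          I.Reachable (ILS.moveToward s t i) (ILS.moveToward s t (i + 1)),
        I.Reachable s (ILS.moveToward s t 1)].TFAE) ∧
    (∃ c : ℕ, 0 < c ∧ ∀ N : ℕ, ∃ x : ReconfInput, N ≤ x.size ∧
      x.I.IsUnit ∧ x.I.InILS 1 ∧ x.I.IsHorn ∧ x.I.IsTVPI ∧ x.I.Reachable x.s x.t ∧
      2 ^ x.size ≤
        (x.I.solutionGraph.dist ⟨x.s, x.s_feasible⟩ ⟨x.t, x.t_feasible⟩) ^ c) :=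
  ⟨polynomiallySolvable_unit_inILS,
    polynomiallySolvable_unit_inILS.mono fun _ h => ⟨h.1, h.2.inILS⟩,
    polynomiallySolvable_unit_inILS.mono fun _ h => ⟨h.1, h.2.inILS⟩,
    ILS.tfae_reachable_moveToward, exponential_dist⟩
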